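/- **Setting.** Let $d\ge 1$, let $S\subset\mathbb R^d$ be a bounded domain with boundary of class $C^4$, let $1<q<\infty$, $T>0$, and let $(\Omega,\mathcal F)$ carry a filtration $(\mathcal F_t)_{t\in[0,T]}$. All spaces are real. Put $E=L^q(S)$, let $\mathcal B=-\Delta$ with $D(\mathcal B)=W^{2,q}(S)\cap W^{1,q}_0(S)$ be the negative Dirichlet Laplacian on $E$, let $E_{1/2}=D(\mathcal B)$ with the graph norm, and $X=E_{1/2}\times E$, with elements written $(x,\dot x)$. Let $b:[0,T]\times\Omega\times S\times\mathbb R\times\mathbb R\to\mathbb R$ be jointly measurable, adapted (for each $t$ the map $b(t,\cdot)$ is measurable for $\mathcal F_t\otimes\mathcal B_S\otimes\mathcal B_{\mathbb R}\otimes\mathcal B_{\mathbb R}$), and Lipschitz and of linear growth in the last two variables, uniformly in the others. For a separable real Hilbert space $\mathcal H$, $\gamma(\mathcal H,Y)$ denotes the $\gamma$-radonifying operators $R$, with norm $(\mathbb E\|\sum_n\gamma_nRh_n\|^2)^{1/2}$, where $(h_n)$ is an orthonormal basis of $\mathcal H$ and $(\gamma_n)$ are independent standard Gaussians. For a finite measure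 $\mu$ on $[0,T]$, $\gamma(\mu;H,Y)$ consists of the functions $\Phi:[0,T]\to\mathcal B(H,Y)$ that represent an operator $R\in\gamma(L^2(\mu;H),Y)$, i.e. $\Phi^*y^*\in L^2(\mu;H)$ and $\langle Rf,y^*\rangle=\int[f,\Phi^*y^*]_H\,d\mu$ for all $f\in L^2(\mu;H)$, $y^*\in Y^*$, with $\|\Phi\|_{\gamma(\mu;H,Y)}=\|R\|_\gamma$. Moreover $L^2_\gamma(\mu;X)=\gamma(\mu;\mathbb R,X)\cap L^2(\mu;X)$ with the sum of the two norms. **Statement.** Let $Q_1\in\mathcal B(L^2(S))$ be a positive, symmetric, compact operator (the covariance of the noise). Then there are $\lambda_n\ge0$ and an orthonormal system $(e_n)_{n\ge1}$ in $L^2(S)$ with $$Q_1=\sum_{n\ge1}\lambda_n\,e_n\otimes e_n .$$ For every such representation with $\sum_n\lambda_n\|e_n\|_\infty^2<\infty$, or more generally with $\big(\sum_n\lambda_n|e_n|^2\big)^{1/2}\in L^\infty(S)$, the operator $i_1=\sum_n\sqrt{\lambda_n}\,e_n\otimes e_n$ is bounded from $L^2(S)$ to $L^\infty(S)$, and with $H_1=L^2(S)$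 the map $B:[0,T]\times\Omega\times X\to\mathcal B(H_1,X)$, $$\big(B(t,\omega,(x,\dot x))h\big)(s)=\begin{pmatrix}0\\ b(t,\omega,s,x(s),\dot x(s))\,(i_1h)(s)\end{pmatrix},$$ satisfies hypothesis (H4) with $a=\theta_B=0$, that is: 1. for all $x\in X$ and $h\in H_1$ the map $(t,\omega)\mapsto B(t,\omega,x)h\in X$ is strongly measurable, and $\omega\mapsto B(t,\omega,x)h$ is strongly $\mathcal F_t$-measurable for each $t$; for all $t,\omega,h$ the map $x\mapsto B(t,\omega,x)h$ is continuous; 2. there are constants $L,C\ge0$ such that for all finite Borel measures $\mu$ on $[0,T]$, all $\omega\in\Omega$ and all $\phi,\phi_1,\phi_2\in L^2_\gamma(\mu;X)$, the function $B(\cdot,\omega,\phi)$ belongs to $\gamma(\mu;H_1,X)$ and $$\|B(\cdot,\omega,\phi_1)-B(\cdot,\omega,\phi_2)\|_{\gamma(\mu;H_1,X)}\le L\,\|\phi_1-\phi_2\|_{L^2_\gamma(\mu;X)},$$ $$\|B(\cdot,\omega,\phi)\|_{\gamma(\mu;H_1,X)}\le C\,\big(\mu([0,T])^{1/2}+\|\phi\|_{L^2_\gamma(\mu;X)}\big).$$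 -/

import Mathlib

open MeasureTheory ProbabilityTheory Filter Topology Set
open scoped ENNReal NNReal

noncomputable section

namespace DampedPlate

/-! ### Gamma-radonifying operators and Gauss functions -/

section Radonifying

/-- The law of a sequence of independent standard real Gaussian random variables, on `ℕ → ℝ`;
the Gaussian sequence itself consists of the coordinates. -/
def gaussianSequence : Measure (ℕ → ℝ) :=
  Measure.infinitePi fun _ : ℕ => gaussianReal 0 1

/-- `h` enumerates an orthonormal basis of `𝓗`; zero vectors are allowed as padding, so that
finite dimensional spaces also have such sequences. -/
structure IsONBSeq {𝓗 : Type*} [NormedAddCommGroup 𝓗] [InnerProductSpace ℝ 𝓗]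
    (h : ℕ → 𝓗) : Prop where
  orthogonal : ∀ m n, m ≠ n → inner ℝ (h m) (h n) = 0
  norm_eq : ∀ n, h n = 0 ∨ ‖h n‖ = 1
  dense : (Submodule.span ℝ (Set.range h)).topologicalClosure = ⊤

variable {𝓗 : Type*} [NormedAddCommGroup 𝓗] [InnerProductSpace ℝ 𝓗]
variable {X : Type*} [NormedAddCommGroup X] [NormedSpace ℝ X]

/-- The partial sums of the Gaussian series `∑ γₙ R hₙ`. -/
def gaussianSum (R : 𝓗 →L[ℝ] X) (h : ℕ → 𝓗) (N : ℕ) (ω : ℕ → ℝ) : X :=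
  ∑ n ∈ Finset.range N, ω n • R (h n)

/-- `h` is an orthonormal basis and the Gaussian series `∑ γₙ R hₙ` converges to `ζ` in
`L²(X)`. -/
structure IsGaussianLimit (R : 𝓗 →L[ℝ] X) (h : ℕ → 𝓗) (ζ : (ℕ → ℝ) → X) : Prop where
  basis : IsONBSeq h
  memLp : MemLp ζ 2 gaussianSequence
  tendsto : Tendsto (fun N => eLpNorm (gaussianSum R h N - ζ) 2 gaussianSequence) atTop (𝓝 0)

/-- `R` belongs to `γ(𝓗, X)`. -/
def IsGammaRadonifying (R : 𝓗 →L[ℝ] X) : Prop :=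
  ∃ h ζ, IsGaussianLimit R h ζ

/-- The norm `(𝔼 ‖∑ γₙ R hₙ‖²)^(1/2)` of `γ(𝓗, X)`. Its value does not depend on the orthonormal
basis, so the infimum is over one value; it is `∞` if `R` is not `γ`-radonifying. -/
def gammaNorm (R : 𝓗 →L[ℝ] X) : ℝ≥0∞ :=
  ⨅ (h : ℕ → 𝓗) (ζ : (ℕ → ℝ) → X) (_ : IsGaussianLimit R h ζ), eLpNorm ζ 2 gaussianSequence

variable {M : Type*} [MeasurableSpace M]
variable {H : Type*} [NormedAddCommGroup H] [InnerProductSpace ℝ H] [CompleteSpace H]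

/-- The function `t ↦ Φ(t)* x*`, with values in `H` through the Riesz isomorphism. -/
def adjointFun (Φ : M → H →L[ℝ] X) (x' : X →L[ℝ] ℝ) (t : M) : H :=
  (InnerProductSpace.toDual ℝ H).symm (x'.comp (Φ t))

/-- The operator `R` on `L²(M, μ; H)` is represented by the function `Φ`. -/
structure IsRepresentedBy (μ : Measure M) (R : Lp H 2 μ →L[ℝ] X) (Φ : M → H →L[ℝ] X) :
    Prop where
  memLp : ∀ x' : X →L[ℝ] ℝ, MemLp (adjointFun Φ x') 2 μ
  pairing : ∀ (f : Lp H 2 μ) (x' : X →L[ℝ] ℝ),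
    x' (R f) = ∫ t, inner ℝ (f t) (adjointFun Φ x' t) ∂μ

/-- `Φ ∈ γ(M, μ; H, X)`. -/
def IsGaussFunction (μ : Measure M) (Φ : M → H →L[ℝ] X) : Prop :=
  ∃ R : Lp H 2 μ →L[ℝ] X, IsRepresentedBy μ R Φ ∧ IsGammaRadonifying R

/-- The norm of `Φ` in `γ(M, μ; H, X)`, that is, the `γ`-norm of the (unique) operator which `Φ`
represents; it is `∞` if `Φ` is not a Gauss function. -/
def gaussNorm (μ : Measure M) (Φ : M → H →L[ℝ] X) : ℝ≥0∞ :=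
  ⨅ (R : Lp H 2 μ →L[ℝ] X) (_ : IsRepresentedBy μ R Φ), gammaNorm R

/-- An `X`-valued function as a function with values in the operators from `ℝ` to `X`. -/
def scalarFun (φ : M → X) (t : M) : ℝ →L[ℝ] X :=
  ContinuousLinearMap.toSpanSingleton ℝ (φ t)

/-- `φ ∈ L²_γ(M, μ; X) = γ(M, μ; X) ∩ L²(M, μ; X)`. -/
def MemLTwoGamma (μ : Measure M) (φ : M → X) : Prop :=
  IsGaussFunction μ (scalarFun φ) ∧ MemLp φ 2 μ

/-- The norm of `L²_γ(M, μ; X)`. -/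
def lTwoGammaNorm (μ : Measure M) (φ : M → X) : ℝ≥0∞ :=
  gaussNorm μ (scalarFun φ) + eLpNorm φ 2 μ

end Radonifying

/-- `L²_γ`-Lipschitz continuity and linear growth, uniformly in `Ω`, of an operator valued map `B : [0,T] × Ω × Z → 𝓑(H, Y)`, where `Z` and `Y`
play the roles of the spaces `X_a` and `X_{-θ_B}`. The growth bound contains the total mass of
`μ`, since the norm of a constant function in `γ(μ; H, Y)` is of order `μ([0,T])^(1/2)`. -/
structure HypothesisH4 {T : ℝ} {Ω : Type*} {mΩ : MeasurableSpace Ω}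
    (𝓕 : Filtration (Icc (0 : ℝ) T) mΩ)
    {Z Y H : Type*} [NormedAddCommGroup Z] [NormedSpace ℝ Z]
    [NormedAddCommGroup Y] [NormedSpace ℝ Y]
    [NormedAddCommGroup H] [InnerProductSpace ℝ H] [CompleteSpace H]
    (B : Icc (0 : ℝ) T → Ω → Z → H →L[ℝ] Y) : Prop where
  stronglyMeasurable : ∀ (x : Z) (h : H),
    StronglyMeasurable fun p : Icc (0 : ℝ) T × Ω => B p.1 p.2 x h
  adapted : ∀ (x : Z) (h : H) (t : Icc (0 : ℝ) T),
    StronglyMeasurable[𝓕 t] fun ω => B t ω x h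
  continuous : ∀ (t : Icc (0 : ℝ) T) (ω : Ω) (h : H), Continuous fun x => B t ω x h
  isGaussFunction : ∀ (μ : Measure (Icc (0 : ℝ) T)) [IsFiniteMeasure μ] (ω : Ω)
    (φ : Icc (0 : ℝ) T → Z), MemLTwoGamma μ φ → IsGaussFunction μ fun t => B t ω (φ t)
  lipschitz : ∃ L : ℝ≥0, ∀ (μ : Measure (Icc (0 : ℝ) T)) [IsFiniteMeasure μ] (ω : Ω)
    (φ₁ φ₂ : Icc (0 : ℝ) T → Z), MemLTwoGamma μ φ₁ → MemLTwoGamma μ φ₂ →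
    gaussNorm μ (fun t => B t ω (φ₁ t) - B t ω (φ₂ t)) ≤
      L * lTwoGammaNorm μ (fun t => φ₁ t - φ₂ t)
  linearGrowth : ∃ C : ℝ≥0, ∀ (μ : Measure (Icc (0 : ℝ) T)) [IsFiniteMeasure μ] (ω : Ω)
    (φ : Icc (0 : ℝ) T → Z), MemLTwoGamma μ φ →
    gaussNorm μ (fun t => B t ω (φ t)) ≤
      C * ((μ univ) ^ (1 / 2 : ℝ) + lTwoGammaNorm μ φ)

/-! ### The spatial domain and Sobolev spaces -/

/-- A bounded domain in `ℝᵈ` with boundary of class `C⁴`: near each boundary point it is the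
sublevel set of a `C⁴` function without critical points. -/
structure SmoothDomain (d : ℕ) where
  carrier : Set (EuclideanSpace ℝ (Fin d))
  isOpen : IsOpen carrier
  isConnected : IsConnected carrier
  isBounded : Bornology.IsBounded carrier
  boundary : ∀ x ∈ frontier carrier, ∃ (U : Set (EuclideanSpace ℝ (Fin d)))
    (r : EuclideanSpace ℝ (Fin d) → ℝ), IsOpen U ∧ x ∈ U ∧ ContDiffOn ℝ 4 r U ∧
      (∀ y ∈ U, fderiv ℝ r y ≠ 0) ∧ carrier ∩ U = {y ∈ U | r y < 0}

section Spaces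

variable {d : ℕ} (S : SmoothDomain d)

/-- Lebesgue measure on `S`. -/
def SmoothDomain.vol : Measure S.carrier :=
  (volume : Measure (EuclideanSpace ℝ (Fin d))).comap Subtype.val

instance : IsFiniteMeasure S.vol := by
  refine ⟨?_⟩
  rw [SmoothDomain.vol, comap_subtype_coe_apply S.isOpen.measurableSet]
  exact lt_of_le_of_lt (measure_mono (by simp)) S.isBounded.measure_lt_top

/-- The real space `L^q(S)`. -/
abbrev LSpace (q : ℝ≥0∞) : Type := Lp ℝ q S.vol

/-- Test functions: smooth functions with compact support in `S`. -/
structure IsTestFunction (φ : EuclideanSpace ℝ (Fin d) → ℝ) : Prop where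
  contDiff : ContDiff ℝ (⊤ : ℕ∞) φ
  compact : HasCompactSupport φ
  support : tsupport φ ⊆ S.carrier

/-- The classical `i`-th partial derivative. -/
def partialDeriv (i : Fin d) (φ : EuclideanSpace ℝ (Fin d) → ℝ)
    (x : EuclideanSpace ℝ (Fin d)) : ℝ :=
  fderiv ℝ φ x (EuclideanSpace.single i 1)

variable (q : ℝ≥0∞) [Fact (1 ≤ q)]

/-- `v` is the weak `i`-th partial derivative of `u` on `S`. -/
def HasWeakPartial (i : Fin d) (u v : LSpace S q) : Prop :=
  ∀ φ, IsTestFunction S φ →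
    ∫ s : S.carrier, u s * partialDeriv i φ s ∂S.vol = - ∫ s : S.carrier, v s * φ s ∂S.vol

/-- The pairs `(φ, ∇φ)` for test functions `φ`, in `L^q(S) × L^q(S)^d`. -/
def testGraph : Set (LSpace S q × (Fin d → LSpace S q)) :=
  {p | ∃ φ, IsTestFunction S φ ∧ (p.1 =ᵐ[S.vol] fun s : S.carrier => φ s) ∧
    ∀ i, p.2 i =ᵐ[S.vol] fun s : S.carrier => partialDeriv i φ s}

/-- `(u, v)` belongs to the graph of the negative Dirichlet Laplacian `𝓑 = -Δ` on `L^q(S)`: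
`u ∈ W^{2,q}(S)` with first and second weak derivatives `g` and `D`, `u` lies in `W^{1,q}_0(S)`,
the closure of the test functions in `W^{1,q}(S)`, and `v = -Δ u`. -/
def IsDirichletLaplacian (u v : LSpace S q) : Prop :=
  ∃ (g : Fin d → LSpace S q) (D : Fin d → Fin d → LSpace S q),
    (∀ i, HasWeakPartial S q i u (g i)) ∧
    (∀ i j, HasWeakPartial S q j (g i) (D i j)) ∧
    (u, g) ∈ closure (testGraph S q) ∧
    v = - ∑ i, D i i

end Spaces

section Linearity

variable {d : ℕ} {S : SmoothDomain d} {q : ℝ≥0∞} [Fact (1 ≤ q)]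

lemma IsTestFunction.add {φ ψ : EuclideanSpace ℝ (Fin d) → ℝ} (hφ : IsTestFunction S φ)
    (hψ : IsTestFunction S ψ) : IsTestFunction S (φ + ψ) :=
  ⟨hφ.contDiff.add hψ.contDiff, hφ.compact.add hψ.compact,
    (tsupport_add φ ψ).trans (union_subset hφ.support hψ.support)⟩

lemma IsTestFunction.smul {φ : EuclideanSpace ℝ (Fin d) → ℝ} (c : ℝ)
    (hφ : IsTestFunction S φ) : IsTestFunction S (c • φ) :=
  ⟨contDiff_const.smul hφ.contDiff, hφ.compact.smul_left (f := fun _ => c),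
    (closure_mono (Function.support_const_smul_subset c φ)).trans hφ.support⟩

lemma partialDeriv_add {φ ψ : EuclideanSpace ℝ (Fin d) → ℝ} (hφ : IsTestFunction S φ)
    (hψ : IsTestFunction S ψ) (i : Fin d) (x : EuclideanSpace ℝ (Fin d)) :
    partialDeriv i (φ + ψ) x = partialDeriv i φ x + partialDeriv i ψ x := by
  unfold partialDeriv
  rw [fderiv_add (hφ.contDiff.differentiable (by simp) x)
    (hψ.contDiff.differentiable (by simp) x)]
  rfl

lemma partialDeriv_smul {φ : EuclideanSpace ℝ (Fin d) → ℝ} (c : ℝ) (hφ : IsTestFunction S φ)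
    (i : Fin d) (x : EuclideanSpace ℝ (Fin d)) :
    partialDeriv i (c • φ) x = c * partialDeriv i φ x := by
  unfold partialDeriv
  rw [fderiv_const_smul (hφ.contDiff.differentiable (by simp) x)]
  rfl

lemma integrable_mul_of_compactSupport (u : LSpace S q) {ψ : EuclideanSpace ℝ (Fin d) → ℝ}
    (hψ : Continuous ψ) (hc : HasCompactSupport ψ) :
    Integrable (fun s : S.carrier => u s * ψ s) S.vol := by
  obtain ⟨C, hC⟩ := hc.exists_bound_of_continuous hψ
  have hu : Integrable u S.vol := (Lp.memLp u).integrable Fact.out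
  refine hu.mul_bdd (c := C) ?_ (Eventually.of_forall fun s => hC s)
  exact (hψ.comp continuous_subtype_val).aestronglyMeasurable

lemma IsTestFunction.continuous_partialDeriv {φ : EuclideanSpace ℝ (Fin d) → ℝ}
    (hφ : IsTestFunction S φ) (i : Fin d) : Continuous (partialDeriv i φ) :=
  (hφ.contDiff.continuous_fderiv (by simp)).clm_apply continuous_const

lemma IsTestFunction.compact_partialDeriv {φ : EuclideanSpace ℝ (Fin d) → ℝ}
    (hφ : IsTestFunction S φ) (i : Fin d) : HasCompactSupport (partialDeriv i φ) :=
  hφ.compact.fderiv_apply (𝕜 := ℝ) (EuclideanSpace.single i 1)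

lemma HasWeakPartial.add {i : Fin d} {u v u' v' : LSpace S q} (h : HasWeakPartial S q i u v)
    (h' : HasWeakPartial S q i u' v') : HasWeakPartial S q i (u + u') (v + v') := by
  intro φ hφ
  have e1 : ∀ (w w' : LSpace S q) (ψ : EuclideanSpace ℝ (Fin d) → ℝ), Continuous ψ →
      HasCompactSupport ψ → ∫ s : S.carrier, (w + w') s * ψ s ∂S.vol =
        (∫ s : S.carrier, w s * ψ s ∂S.vol) + ∫ s : S.carrier, w' s * ψ s ∂S.vol := by
    intro w w' ψ hψ hc
    rw [← integral_add (integrable_mul_of_compactSupport w hψ hc)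
      (integrable_mul_of_compactSupport w' hψ hc)]
    refine integral_congr_ae ?_
    filter_upwards [Lp.coeFn_add w w'] with s hs
    rw [hs, Pi.add_apply, add_mul]
  rw [e1 _ _ _ (hφ.continuous_partialDeriv i) (hφ.compact_partialDeriv i),
    e1 _ _ _ hφ.contDiff.continuous hφ.compact, h φ hφ, h' φ hφ, neg_add]

lemma HasWeakPartial.smul {i : Fin d} {u v : LSpace S q} (c : ℝ)
    (h : HasWeakPartial S q i u v) : HasWeakPartial S q i (c • u) (c • v) := by
  intro φ hφ
  have e1 : ∀ (w : LSpace S q) (ψ : EuclideanSpace ℝ (Fin d) → ℝ),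
      ∫ s : S.carrier, (c • w) s * ψ s ∂S.vol = c * ∫ s : S.carrier, w s * ψ s ∂S.vol := by
    intro w ψ
    rw [← integral_const_mul]
    refine integral_congr_ae ?_
    filter_upwards [Lp.coeFn_smul c w] with s hs
    rw [hs, Pi.smul_apply, smul_eq_mul, mul_assoc]
  rw [e1, e1, h φ hφ, mul_neg]

variable (S q) in
/-- The pairs `(φ, ∇φ)` form a linear subspace. -/
def testSubmodule : Submodule ℝ (LSpace S q × (Fin d → LSpace S q)) where
  carrier := testGraph S q
  add_mem' := by
    rintro p p' ⟨φ, hφ, h1, h2⟩ ⟨φ', hφ', h1', h2'⟩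
    refine ⟨φ + φ', hφ.add hφ', ?_, fun i => ?_⟩
    · filter_upwards [h1, h1', Lp.coeFn_add p.1 p'.1] with s a b c
      rw [Prod.fst_add, c, Pi.add_apply, a, b, Pi.add_apply]
    · filter_upwards [h2 i, h2' i, Lp.coeFn_add (p.2 i) (p'.2 i)] with s a b c
      rw [Prod.snd_add, Pi.add_apply, c, Pi.add_apply, a, b, partialDeriv_add hφ hφ']
  zero_mem' := by
    have hz : IsTestFunction S (0 : EuclideanSpace ℝ (Fin d) → ℝ) :=
      ⟨contDiff_const, HasCompactSupport.zero, by simp⟩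
    refine ⟨0, hz, ?_, fun i => ?_⟩
    · filter_upwards [Lp.coeFn_zero ℝ q S.vol] with s a
      rw [Prod.fst_zero, a]; rfl
    · filter_upwards [Lp.coeFn_zero ℝ q S.vol] with s a
      rw [Prod.snd_zero, Pi.zero_apply, a]
      simp [partialDeriv]
  smul_mem' := by
    rintro c p ⟨φ, hφ, h1, h2⟩
    refine ⟨c • φ, hφ.smul c, ?_, fun i => ?_⟩
    · filter_upwards [h1, Lp.coeFn_smul c p.1] with s a b
      rw [Prod.smul_fst, b, Pi.smul_apply, a, Pi.smul_apply]
    · filter_upwards [h2 i, Lp.coeFn_smul c (p.2 i)] with s a b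
      rw [Prod.smul_snd, Pi.smul_apply, b, Pi.smul_apply, a, partialDeriv_smul c hφ, smul_eq_mul]

variable (S q) in
/-- The graph of the negative Dirichlet Laplacian `𝓑`. -/
def laplacianGraph : Submodule ℝ (LSpace S q × LSpace S q) where
  carrier := {p | IsDirichletLaplacian S q p.1 p.2}
  add_mem' := by
    rintro p p' ⟨g, D, h1, h2, h3, h4⟩ ⟨g', D', h1', h2', h3', h4'⟩
    refine ⟨g + g', D + D', fun i => (h1 i).add (h1' i), fun i j => (h2 i j).add (h2' i j), ?_, ?_⟩
    · exact (testSubmodule S q).topologicalClosure.add_mem h3 h3'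
    · simp only [Prod.snd_add, h4, h4', Pi.add_apply, Finset.sum_add_distrib, neg_add]
  zero_mem' := by
    have hz : ∀ i, HasWeakPartial S q i 0 0 := by
      intro i
      have hs : ∀ ψ : EuclideanSpace ℝ (Fin d) → ℝ,
          ∫ s : S.carrier, (0 : LSpace S q) s * ψ s ∂S.vol = 0 := by
        intro ψ
        rw [← integral_zero S.carrier ℝ (μ := S.vol)]
        refine integral_congr_ae ?_
        filter_upwards [Lp.coeFn_zero ℝ q S.vol] with s a
        rw [a, Pi.zero_apply, zero_mul]
      intro φ _
      rw [hs, hs, neg_zero]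
    refine ⟨0, 0, hz, fun i j => hz j, ?_, by simp⟩
    exact (testSubmodule S q).topologicalClosure.zero_mem
  smul_mem' := by
    rintro c p ⟨g, D, h1, h2, h3, h4⟩
    refine ⟨c • g, c • D, fun i => (h1 i).smul c, fun i j => (h2 i j).smul c, ?_, ?_⟩
    · exact (testSubmodule S q).topologicalClosure.smul_mem c h3
    · simp only [Prod.smul_snd, h4, Pi.smul_apply, Finset.smul_sum, smul_neg]

end Linearity

section Operator

variable {d : ℕ} (S : SmoothDomain d) (q : ℝ≥0∞) [Fact (1 ≤ q)]

/-- The space `E_{1/2} = D(𝓑) = W^{2,q}(S) ∩ W^{1,q}_0(S)` with the graph norm of `𝓑`,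
realized as the graph of `𝓑`. -/
abbrev EHalf : Type := laplacianGraph S q

/-- The state space `X = E_{1/2} × E` with `E = L^q(S)`. -/
abbrev StateSpace : Type := EHalf S q × LSpace S q

variable {S q}

/-- The first component `x` of a state `(x, ẋ)`, as a function in `L^q(S)`. -/
def position (x : StateSpace S q) : LSpace S q := (x.1 : LSpace S q × LSpace S q).1

/-- The second component `ẋ` of a state `(x, ẋ)`. -/
def velocity (x : StateSpace S q) : LSpace S q := x.2

variable {T : ℝ} {Ω : Type*} {mΩ : MeasurableSpace Ω}

/-- The assumptions on the coefficient `b(t, ω, s, x, y)`: it is jointly measurable, adapted (for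
each time `t` it is jointly measurable with respect to `𝓕 t` in `ω` and the Borel sets in the
other variables), and Lipschitz and of linear growth in `(x, y)`, uniformly in `(t, ω, s)`. -/
structure IsCoefficient (S : SmoothDomain d) (𝓕 : Filtration (Icc (0 : ℝ) T) mΩ)
    (b : Icc (0 : ℝ) T → Ω → S.carrier → ℝ → ℝ → ℝ) : Prop where
  measurable : Measurable fun p : Icc (0 : ℝ) T × Ω × S.carrier × ℝ × ℝ =>
    b p.1 p.2.1 p.2.2.1 p.2.2.2.1 p.2.2.2.2
  adapted : ∀ t, Measurable[(𝓕 t).prod inferInstance] fun p : Ω × S.carrier × ℝ × ℝ =>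
    b t p.1 p.2.1 p.2.2.1 p.2.2.2
  lipschitz : ∃ L : ℝ, ∀ t ω s x y x' y',
    |b t ω s x y - b t ω s x' y'| ≤ L * (|x - x'| + |y - y'|)
  linearGrowth : ∃ C : ℝ, ∀ t ω s x y, |b t ω s x y| ≤ C * (1 + |x| + |y|)

variable {𝓕 : Filtration (Icc (0 : ℝ) T) mΩ} {b : Icc (0 : ℝ) T → Ω → S.carrier → ℝ → ℝ → ℝ}

lemma IsCoefficient.memLp (hb : IsCoefficient S 𝓕 b) (t : Icc (0 : ℝ) T) (ω : Ω)
    (u v : LSpace S q) : MemLp (fun s => b t ω s (u s) (v s)) q S.vol := by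
  obtain ⟨C, hC⟩ := hb.linearGrowth
  have hg : MemLp (fun s => C * (1 + |u s| + |v s|)) q S.vol :=
    (((memLp_const (1 : ℝ)).add (Lp.memLp u).norm).add (Lp.memLp v).norm).const_mul C
  refine hg.mono' ?_ (Eventually.of_forall fun s => hC t ω s _ _)
  have hu : Measurable u := (Lp.stronglyMeasurable u).measurable
  have hv : Measurable v := (Lp.stronglyMeasurable v).measurable
  have hm : Measurable fun s : S.carrier => (t, ω, s, u s, v s) := by fun_prop
  exact (hb.measurable.comp hm).aestronglyMeasurable

/-- The function `s ↦ b(t, ω, s, x(s), ẋ(s))` in `L^q(S)`, for a state `(x, ẋ)`. -/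
def superposition (hb : IsCoefficient S 𝓕 b) (t : Icc (0 : ℝ) T) (ω : Ω)
    (x : StateSpace S q) : LSpace S q :=
  (hb.memLp t ω (position x) (velocity x)).toLp _

/-- The operator `B(t, ω, x) : L²(S) → X`, which maps `h` to the pair with first component `0`
and second component `s ↦ b(t, ω, s, x(s), ẋ(s)) (i₁ h)(s)`. -/
def noiseOperator (hb : IsCoefficient S 𝓕 b) (i₁ : LSpace S 2 →L[ℝ] LSpace S ∞)
    (t : Icc (0 : ℝ) T) (ω : Ω) (x : StateSpace S q) : LSpace S 2 →L[ℝ] StateSpace S q :=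
  (ContinuousLinearMap.inr ℝ (EHalf S q) (LSpace S q)).comp
    (((ContinuousLinearMap.mul ℝ ℝ).holderL S.vol q ∞ q (superposition hb t ω x)).comp i₁)

/-- `Q = ∑ λₙ eₙ ⊗ eₙ` with an orthonormal system `e` in `L²(S)` and numbers `λₙ ≥ 0`. -/
structure IsSpectralDecomposition (Q : LSpace S 2 →L[ℝ] LSpace S 2) (lam : ℕ → ℝ)
    (e : ℕ → LSpace S 2) : Prop where
  nonneg : ∀ n, 0 ≤ lam n
  orthonormal : Orthonormal ℝ e
  hasSum : ∀ h, HasSum (fun n => (lam n * inner ℝ (e n) h) • e n) (Q h)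

/-- `i₁ : L²(S) → L^∞(S)` is the operator `∑ √λₙ eₙ ⊗ eₙ`; the series `∑ √λₙ ⟨eₙ, h⟩ eₙ`
is understood in `L²(S)`. -/
def IsNoiseEmbedding (lam : ℕ → ℝ) (e : ℕ → LSpace S 2)
    (i₁ : LSpace S 2 →L[ℝ] LSpace S ∞) : Prop :=
  ∀ h, ∃ g : LSpace S 2, HasSum (fun n => (√(lam n) * inner ℝ (e n) h) • e n) g ∧
    i₁ h =ᵐ[S.vol] g

end Operator

end DampedPlate

end

/-!
The argument rests on the identification of `γ(G, L^q)`, for a separable Hilbert space `G`, with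
`L^q(S; G)`. An operator `R : G → L^q` with `(R g)(s) = ⟨Ψ(s), g⟩` is `γ`-radonifying if and only if
`‖Ψ‖ ∈ L^q`, and its `γ`-norm is equivalent to the `L^q`-norm of `‖Ψ‖`. For finite sums this is the
comparison of a Gaussian sum `∑ γₙ uₙ` in `L²(L^q)` with the square function `(∑ |uₙ|²)^(1/2)`
(`exists_gaussSum_le`, `exists_squareFun_le`): pointwise in `s` the sum is a Gaussian variable with
variance `∑ |uₙ(s)|²`, and the order of the `L²`- and `L^q`-norms is exchanged by Jensen's
inequality or by Hölder's inequality with a power of the square function as weight. The passage to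
series is `exists_isGaussianLimit_le` and `exists_squareFun_le_of_isGaussianLimit`.

For `G = L²(μ; ℝ)` the second estimate shows that a function `ψ ∈ L²_γ(μ; X)` has components with a
jointly measurable representative `f(t, s)` whose sections `f(·, s)` lie in `L²(μ)`, with the
`L^q`-norm of `s ↦ ‖f(·, s)‖_{L²(μ)}` bounded by the `γ`-norm of `ψ`
(`ae_lintegral_sq_le_tsum`, `exists_squareFun_le_gaussNorm`). Only the embedding of the domain of
the Dirichlet Laplacian into `L^q(S)` enters here.

The condition on the noise says that `k(s) = ∑ √λₙ eₙ(s) eₙ` is a bounded function with values in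
`L²(S)`, and `(i₁ h)(s) = ⟨k(s), h⟩` (`exists_isBoundedKernel`). For a multiplier `Θ` with
representative `θ(t, s)`, the operator represented by `t ↦ Θ(t) · i₁` is therefore given by the kernel
`Ψ(s) = θ(·, s) k(s)` in `L²(μ; L²(S))`, whose norm is at most `K ‖θ(·, s)‖_{L²(μ)}`, and the first
estimate applies (`exists_isRepresentedBy_isGaussianLimit`). With
`θ(t, s) = b(t, ω, s, x(t, s), ẋ(t, s))`, or a difference of two such functions, the Lipschitz and
growth conditions on `b` bound `θ` pointwise by the components of `ψ`, and Minkowski's inequality in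
`L²(μ)` gives the bound by the `γ`-norm of `ψ` (`exists_gaussNorm_mulBilin_le`).
-/

noncomputable section

namespace DampedPlate

/-! ### Gaussian sums -/

instance : IsProbabilityMeasure gaussianSequence := by
  unfold gaussianSequence; infer_instance

/-- The Gaussian sum `∑ₙ aₙ γₙ` has law `N(0, ∑ₙ aₙ²)`. -/
lemma map_gaussianSequence_sum (a : ℕ → ℝ) (F : Finset ℕ) :
    gaussianSequence.map (fun ω => ∑ n ∈ F, ω n * a n) =
      gaussianReal 0 (∑ n ∈ F, ‖a n‖₊ ^ 2) := by
  have hind : iIndepFun (fun n (ω : ℕ → ℝ) => ω n * a n) gaussianSequence :=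
    iIndepFun_infinitePi (X := fun n (x : ℝ) => x * a n) (fun n => by fun_prop)
  have hlaw : ∀ n, gaussianSequence.map (fun ω : ℕ → ℝ => ω n * a n) =
      gaussianReal 0 (‖a n‖₊ ^ 2) := by
    intro n
    have h1 : gaussianSequence.map (fun ω : ℕ → ℝ => ω n) = gaussianReal 0 1 :=
      Measure.infinitePi_map_eval (μ := fun _ : ℕ => gaussianReal 0 1) n
    have h2 : (fun ω : ℕ → ℝ => ω n * a n) = (fun x => a n * x) ∘ (fun ω : ℕ → ℝ => ω n) := by
      ext ω; simp [mul_comm]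
    rw [h2, ← Measure.map_map (by fun_prop) (by fun_prop), h1, gaussianReal_map_const_mul]
    congr 1
    · simp
    · ext; simp
  classical
  induction F using Finset.induction_on with
  | empty =>
    simp only [Finset.sum_empty, gaussianReal_zero_var, Measure.map_const, measure_univ, one_smul]
  | insert m F hm ih =>
    have e : (fun ω : ℕ → ℝ => ∑ n ∈ insert m F, ω n * a n) =
        (∑ n ∈ F, fun ω : ℕ → ℝ => ω n * a n) + fun ω : ℕ → ℝ => ω m * a m := by
      ext ω; simp [Finset.sum_insert hm, add_comm]
    have e' : (fun ω : ℕ → ℝ => ∑ n ∈ F, ω n * a n) = ∑ n ∈ F, fun ω : ℕ → ℝ => ω n * a n := by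
      ext ω; simp
    rw [e, gaussianReal_add_gaussianReal_of_indepFun
      (hind.indepFun_finsetSum_of_notMem (fun n => by fun_prop) hm) (e' ▸ ih) (hlaw m),
      Finset.sum_insert hm]
    simp [add_comm]

/-- The absolute moment of order `r` of a standard Gaussian variable. -/
def gaussianMoment (r : ℝ) : ℝ≥0∞ := ∫⁻ x, ‖x‖ₑ ^ r ∂gaussianReal 0 1

lemma gaussianMoment_ne_top {r : ℝ} (hr : 0 < r) : gaussianMoment r ≠ ∞ := by
  have h := (memLp_id_gaussianReal' (μ := 0) (v := 1) (ENNReal.ofReal r)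
    ENNReal.ofReal_ne_top).eLpNorm_lt_top
  rw [eLpNorm_lt_top_iff_lintegral_rpow_enorm_lt_top (by simpa using hr)
    ENNReal.ofReal_ne_top, ENNReal.toReal_ofReal hr.le] at h
  exact h.ne

lemma gaussianMoment_ne_zero {r : ℝ} (hr : 0 < r) : gaussianMoment r ≠ 0 := by
  intro h
  have := nullSingletonClass_gaussianReal (μ := 0) (v := 1) one_ne_zero
  rw [gaussianMoment, lintegral_eq_zero_iff (by fun_prop)] at h
  have h2 : ∀ᵐ x ∂gaussianReal 0 1, x ∈ ({0} : Set ℝ) := by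
    filter_upwards [h] with x hx
    simpa [hr.not_gt, hr] using hx
  have h3 : (gaussianReal 0 1) {(0 : ℝ)}ᶜ = 0 := h2
  rw [prob_compl_eq_zero_iff (measurableSet_singleton _)] at h3
  simp at h3

lemma gaussianMoment_two : gaussianMoment 2 = 1 := by
  have h := variance_id_gaussianReal (μ := 0) (v := 1)
  have h2 : evariance id (gaussianReal 0 1) = 1 := by
    rw [← (memLp_id_gaussianReal' 2 (by simp)).ofReal_variance_eq, h]; simp
  rw [evariance_eq_lintegral_ofReal] at h2
  rw [← h2, gaussianMoment]
  refine lintegral_congr fun x => ?_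
  simp only [id, integral_id_gaussianReal, sub_zero, ENNReal.rpow_ofNat]
  rw [← ofReal_norm, ← ENNReal.ofReal_pow (norm_nonneg _), Real.norm_eq_abs, sq_abs]

lemma lintegral_gaussian_sum (a : ℕ → ℝ) (F : Finset ℕ) {r : ℝ} (hr : 0 < r) :
    ∫⁻ ω, ‖∑ n ∈ F, ω n * a n‖ₑ ^ r ∂gaussianSequence =
      gaussianMoment r * (∑ n ∈ F, ‖a n‖ₑ ^ 2) ^ (r / 2) := by
  set v : ℝ≥0 := ∑ n ∈ F, ‖a n‖₊ ^ 2 with hv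
  have hv' : (∑ n ∈ F, ‖a n‖ₑ ^ 2) = (v : ℝ≥0∞) := by
    simp [hv, enorm]
  have h1 : gaussianReal 0 v = (gaussianReal 0 1).map (fun x => (NNReal.sqrt v : ℝ) * x) := by
    rw [gaussianReal_map_const_mul]
    congr 1
    · simp
    · ext; simp
  have h2 : ∫⁻ ω, ‖∑ n ∈ F, ω n * a n‖ₑ ^ r ∂gaussianSequence =
      ∫⁻ x, ‖x‖ₑ ^ r ∂(gaussianSequence.map (fun ω => ∑ n ∈ F, ω n * a n)) := by
    rw [lintegral_map (by fun_prop) (by fun_prop)]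
  rw [h2, map_gaussianSequence_sum, h1, lintegral_map (by fun_prop) (by fun_prop), hv']
  simp_rw [enorm_mul, ENNReal.mul_rpow_of_nonneg _ _ hr.le]
  rw [lintegral_const_mul _ (by fun_prop), gaussianMoment, mul_comm]
  congr 1
  rw [NNReal.enorm_eq, NNReal.sqrt_eq_rpow, ENNReal.coe_rpow_of_nonneg _ (by norm_num),
    ← ENNReal.rpow_mul]
  congr 1; ring

/-! ### Mixed norms of random functions -/

section MixedNorm

variable {Ω' α : Type*} [MeasurableSpace Ω'] [MeasurableSpace α]
  {P : Measure Ω'} [IsProbabilityMeasure P] {ν : Measure α} [SFinite ν]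

lemma lintegral_rpow_le_rpow_lintegral {f : Ω' → ℝ≥0∞} (hf : AEMeasurable f P) {t : ℝ}
    (ht : 0 ≤ t) (ht1 : t ≤ 1) : ∫⁻ ω, f ω ^ t ∂P ≤ (∫⁻ ω, f ω ∂P) ^ t := by
  have h := ENNReal.lintegral_mul_norm_pow_le hf (aemeasurable_const (b := (1 : ℝ≥0∞))) ht
    (sub_nonneg.2 ht1) (by ring)
  simpa using h

variable {ξ : Ω' → α → ℝ≥0∞} {V : α → ℝ≥0∞} {r : ℝ}

lemma lintegral_mixed_le_of_two_le (hξ : Measurable (Function.uncurry ξ)) {m : ℝ≥0∞}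
    (hr : 2 ≤ r) (hm : ∀ s, ∫⁻ ω, ξ ω s ^ r ∂P = m * V s ^ (r / 2)) (hV : Measurable V) :
    ∫⁻ ω, (∫⁻ s, ξ ω s ^ r ∂ν) ^ (2 / r) ∂P ≤ (m * ∫⁻ s, V s ^ (r / 2) ∂ν) ^ (2 / r) := by
  have hr0 : 0 < r := by linarith
  have hmeas : Measurable fun ω => ∫⁻ s, ξ ω s ^ r ∂ν :=
    Measurable.lintegral_prod_right' (f := fun p : Ω' × α => ξ p.1 p.2 ^ r) (hξ.pow_const r)
  refine (lintegral_rpow_le_rpow_lintegral hmeas.aemeasurable (by positivity)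
    ((div_le_one hr0).2 hr)).trans_eq ?_
  rw [lintegral_lintegral_swap (hξ.pow_const r).aemeasurable]
  simp_rw [hm]
  rw [lintegral_const_mul _ (by fun_prop)]

/-- Hölder's inequality with the weight `V ^ (r / 2 - 1)` replaces Minkowski's integral
inequality. -/
lemma lintegral_mixed_le_of_le_two (hξ : Measurable (Function.uncurry ξ)) (hr0 : 0 < r)
    (hr : r ≤ 2) (hm : ∀ s, ∫⁻ ω, ξ ω s ^ (2 : ℝ) ∂P = V s) (hV : Measurable V)
    (hV0 : ∀ s, V s = 0 → ∀ ω, ξ ω s = 0) (hVt : ∀ s, V s ≠ ∞) :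
    ∫⁻ ω, (∫⁻ s, ξ ω s ^ r ∂ν) ^ (2 / r) ∂P ≤ (∫⁻ s, V s ^ (r / 2) ∂ν) ^ (2 / r) := by
  have h1 : ∀ ω, ∫⁻ s, ξ ω s ^ r ∂ν ≤
      (∫⁻ s, ξ ω s ^ (2 : ℝ) * V s ^ (r / 2 - 1) ∂ν) ^ (r / 2) *
        (∫⁻ s, V s ^ (r / 2) ∂ν) ^ (1 - r / 2) := by
    intro ω
    have hω : Measurable (ξ ω) := hξ.of_uncurry_left
    refine le_trans (lintegral_mono fun s => ?_) (ENNReal.lintegral_mul_norm_pow_le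
      (by fun_prop) (by fun_prop) (by positivity) (by linarith) (by ring))
    by_cases h0 : V s = 0
    · simp [hV0 s h0 ω, hr0]
    · rw [ENNReal.mul_rpow_of_nonneg _ _ (by positivity), ← ENNReal.rpow_mul, mul_assoc,
        ← ENNReal.rpow_mul, ← ENNReal.rpow_mul, ← ENNReal.rpow_add _ _ h0 (hVt s)]
      rw [show (r / 2 - 1) * (r / 2) + r / 2 * (1 - r / 2) = 0 by ring,
        show 2 * (r / 2) = r by ring]
      simp
  set I := ∫⁻ s, V s ^ (r / 2) ∂ν with hI
  have h2 : ∀ ω, (∫⁻ s, ξ ω s ^ r ∂ν) ^ (2 / r) ≤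
      (∫⁻ s, ξ ω s ^ (2 : ℝ) * V s ^ (r / 2 - 1) ∂ν) * I ^ (2 / r - 1) := by
    intro ω
    refine (ENNReal.rpow_le_rpow (h1 ω) (by positivity)).trans_eq ?_
    rw [ENNReal.mul_rpow_of_nonneg _ _ (by positivity), ← ENNReal.rpow_mul, ← ENNReal.rpow_mul]
    rw [show r / 2 * (2 / r) = 1 by field_simp,
      show (1 - r / 2) * (2 / r) = 2 / r - 1 by field_simp, ENNReal.rpow_one]
  have hmeas : Measurable (Function.uncurry fun (ω : Ω') (s : α) =>
      ξ ω s ^ (2 : ℝ) * V s ^ (r / 2 - 1)) :=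
    (hξ.pow_const _).mul ((hV.comp measurable_snd).pow_const _)
  have hmeas' : Measurable fun ω => ∫⁻ s, ξ ω s ^ (2 : ℝ) * V s ^ (r / 2 - 1) ∂ν :=
    hmeas.lintegral_prod_right'
  have hle : (∫⁻ s, V s * V s ^ (r / 2 - 1) ∂ν) ≤ I := by
    refine lintegral_mono fun s => ?_
    by_cases h0 : V s = 0
    · simp [h0]
    · conv_lhs => enter [1]; rw [← ENNReal.rpow_one (V s)]
      rw [← ENNReal.rpow_add _ _ h0 (hVt s)]
      simp
  calc _ ≤ ∫⁻ ω, (∫⁻ s, ξ ω s ^ (2 : ℝ) * V s ^ (r / 2 - 1) ∂ν) * I ^ (2 / r - 1) ∂P :=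
        lintegral_mono h2
    _ = (∫⁻ s, V s * V s ^ (r / 2 - 1) ∂ν) * I ^ (2 / r - 1) := by
        rw [lintegral_mul_const _ hmeas', lintegral_lintegral_swap hmeas.aemeasurable]
        congr 1
        refine lintegral_congr fun s => ?_
        have : Measurable fun ω => ξ ω s := hξ.of_uncurry_right
        rw [lintegral_mul_const _ (by fun_prop), hm]
    _ ≤ I ^ (1 : ℝ) * I ^ (2 / r - 1) := by rw [ENNReal.rpow_one]; gcongr
    _ = I ^ (2 / r) := by
        rw [← ENNReal.rpow_add_of_nonneg _ _ zero_le_one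
          (by rw [sub_nonneg, le_div_iff₀ hr0]; linarith)]
        congr 1; ring

lemma le_lintegral_mixed_of_le_two (hξ : Measurable (Function.uncurry ξ)) {m : ℝ≥0∞}
    (hr0 : 0 < r) (hr : r ≤ 2) (hm : ∀ s, ∫⁻ ω, ξ ω s ^ r ∂P = m * V s ^ (r / 2))
    (hV : Measurable V) :
    (m * ∫⁻ s, V s ^ (r / 2) ∂ν) ^ (2 / r) ≤ ∫⁻ ω, (∫⁻ s, ξ ω s ^ r ∂ν) ^ (2 / r) ∂P := by
  have hmeas : Measurable fun ω => ∫⁻ s, ξ ω s ^ r ∂ν :=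
    Measurable.lintegral_prod_right' (f := fun p : Ω' × α => ξ p.1 p.2 ^ r) (hξ.pow_const r)
  have h := lintegral_rpow_le_rpow_lintegral (P := P) (hmeas.pow_const (2 / r)).aemeasurable
    (t := r / 2) (by positivity) (by linarith)
  simp_rw [← ENNReal.rpow_mul] at h
  rw [show 2 / r * (r / 2) = 1 by field_simp] at h
  simp_rw [ENNReal.rpow_one] at h
  rw [lintegral_lintegral_swap (hξ.pow_const r).aemeasurable] at h
  simp_rw [hm] at h
  rw [lintegral_const_mul _ (by fun_prop)] at h
  refine (ENNReal.rpow_le_rpow h (by positivity)).trans_eq ?_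
  rw [← ENNReal.rpow_mul, show r / 2 * (2 / r) = 1 by field_simp, ENNReal.rpow_one]

/-- As in `lintegral_mixed_le_of_le_two`, Hölder's inequality with a power of `V` as weight
replaces Minkowski's integral inequality; the finiteness assumption serves to divide by a power
of the integral. -/
lemma le_lintegral_mixed_of_two_le (hξ : Measurable (Function.uncurry ξ)) (hr : 2 ≤ r)
    (hm : ∀ s, ∫⁻ ω, ξ ω s ^ (2 : ℝ) ∂P = V s) (hV : Measurable V)
    (hfin : ∫⁻ s, V s ^ (r / 2) ∂ν ≠ ∞) :
    (∫⁻ s, V s ^ (r / 2) ∂ν) ^ (2 / r) ≤ ∫⁻ ω, (∫⁻ s, ξ ω s ^ r ∂ν) ^ (2 / r) ∂P := by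
  have hr0 : 0 < r := by linarith
  have hr1 : 2 / r ≤ 1 := (div_le_one hr0).2 hr
  set I := ∫⁻ s, V s ^ (r / 2) ∂ν with hI
  by_cases hI0 : I = 0
  · rw [hI0, ENNReal.zero_rpow_of_pos (by positivity)]; exact zero_le
  have hmeas : Measurable (Function.uncurry fun (ω : Ω') (s : α) =>
      ξ ω s ^ (2 : ℝ) * V s ^ (r / 2 - 1)) :=
    (hξ.pow_const _).mul ((hV.comp measurable_snd).pow_const _)
  have hmeas' : Measurable fun ω => ∫⁻ s, ξ ω s ^ r ∂ν :=
    Measurable.lintegral_prod_right' (f := fun p : Ω' × α => ξ p.1 p.2 ^ r) (hξ.pow_const r)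
  have h1 : ∀ ω, ∫⁻ s, ξ ω s ^ (2 : ℝ) * V s ^ (r / 2 - 1) ∂ν ≤
      (∫⁻ s, ξ ω s ^ r ∂ν) ^ (2 / r) * I ^ (1 - 2 / r) := by
    intro ω
    have hω : Measurable (ξ ω) := hξ.of_uncurry_left
    refine le_trans (lintegral_mono fun s => ?_) (ENNReal.lintegral_mul_norm_pow_le
      (by fun_prop) (by fun_prop) (by positivity) (by linarith) (by ring))
    rw [← ENNReal.rpow_mul, ← ENNReal.rpow_mul, show r * (2 / r) = 2 by field_simp,
      show r / 2 * (1 - 2 / r) = r / 2 - 1 by field_simp]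
  have h2 : I ≤ (∫⁻ ω, (∫⁻ s, ξ ω s ^ r ∂ν) ^ (2 / r) ∂P) * I ^ (1 - 2 / r) := by
    calc I = ∫⁻ s, V s * V s ^ (r / 2 - 1) ∂ν := by
          refine lintegral_congr fun s => ?_
          conv_rhs => enter [1]; rw [← ENNReal.rpow_one (V s)]
          rw [← ENNReal.rpow_add_of_nonneg _ _ zero_le_one (by linarith)]
          congr 1; ring
      _ = ∫⁻ ω, ∫⁻ s, ξ ω s ^ (2 : ℝ) * V s ^ (r / 2 - 1) ∂ν ∂P := by
          rw [lintegral_lintegral_swap hmeas.aemeasurable]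
          refine lintegral_congr fun s => ?_
          have : Measurable fun ω => ξ ω s := hξ.of_uncurry_right
          rw [lintegral_mul_const _ (by fun_prop), hm]
      _ ≤ _ := by
          rw [← lintegral_mul_const _ (by fun_prop)]
          exact lintegral_mono h1
  have h3 : I ^ (1 - 2 / r) ≠ 0 := by simp [hI0, hfin]
  have h4 : I ^ (1 - 2 / r) ≠ ∞ := by simp [hI0, hfin]
  rw [← ENNReal.div_le_iff h3 h4] at h2
  refine le_trans (le_of_eq ?_) h2
  conv_rhs => enter [1]; rw [← ENNReal.rpow_one I]
  rw [← ENNReal.rpow_sub _ _ hI0 hfin]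
  congr 1; ring

end MixedNorm

/-! ### Gaussian sums in `L^q` are comparable with the square function -/

section SquareFunction

variable {α : Type*} [MeasurableSpace α] {ν : Measure α} {q : ℝ≥0∞}

/-- The square function `(∑ₙ |uₙ|²)^(1/2)` of finitely many functions. -/
def squareFun (u : ℕ → Lp ℝ q ν) (F : Finset ℕ) (s : α) : ℝ≥0∞ :=
  (∑ n ∈ F, ‖u n s‖ₑ ^ 2) ^ (1 / 2 : ℝ)

/-- The Gaussian sum `∑ₙ γₙ uₙ` over a finite set. -/
def gaussSum (u : ℕ → Lp ℝ q ν) (F : Finset ℕ) (ω : ℕ → ℝ) : Lp ℝ q ν :=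
  ∑ n ∈ F, ω n • u n

lemma measurable_squareFun (u : ℕ → Lp ℝ q ν) (F : Finset ℕ) : Measurable (squareFun u F) := by
  have : ∀ n, Measurable (u n) := fun n => (Lp.stronglyMeasurable (u n)).measurable
  unfold squareFun
  fun_prop

lemma coeFn_gaussSum (u : ℕ → Lp ℝ q ν) (F : Finset ℕ) (ω : ℕ → ℝ) :
    gaussSum u F ω =ᵐ[ν] fun s => ∑ n ∈ F, ω n * u n s := by
  have h1 := Lp.coeFn_finsetSum F (fun n => ω n • u n)
  have h2 : ∀ᵐ s ∂ν, ∀ n, (ω n • u n : Lp ℝ q ν) s = ω n * u n s :=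
    ae_all_iff.2 fun n => Lp.coeFn_smul (ω n) (u n)
  filter_upwards [h1, h2] with s a b
  rw [gaussSum, a, Finset.sum_apply]
  exact Finset.sum_congr rfl fun n _ => b n

lemma eLpNorm_gaussSum_two (hq0 : q ≠ 0) (hq : q ≠ ∞) (u : ℕ → Lp ℝ q ν) (F : Finset ℕ) :
    eLpNorm (gaussSum u F) 2 gaussianSequence =
      (∫⁻ ω, (∫⁻ s, ‖∑ n ∈ F, ω n * u n s‖ₑ ^ q.toReal ∂ν) ^ (2 / q.toReal)
        ∂gaussianSequence) ^ (1 / 2 : ℝ) := by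
  rw [eLpNorm_eq_lintegral_rpow_enorm_toReal two_ne_zero ENNReal.ofNat_ne_top]
  simp only [ENNReal.toReal_ofNat]
  congr 1
  refine lintegral_congr fun ω => ?_
  rw [Lp.enorm_def, eLpNorm_congr_ae (coeFn_gaussSum u F ω),
    eLpNorm_eq_lintegral_rpow_enorm_toReal hq0 hq, ← ENNReal.rpow_mul]
  congr 1; ring

lemma eLpNorm_squareFun (hq0 : q ≠ 0) (hq : q ≠ ∞) (u : ℕ → Lp ℝ q ν) (F : Finset ℕ) :
    eLpNorm (squareFun u F) q ν =
      ((∫⁻ s, (∑ n ∈ F, ‖u n s‖ₑ ^ 2) ^ (q.toReal / 2) ∂ν) ^ (2 / q.toReal)) ^ (1 / 2 : ℝ) := by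
  rw [eLpNorm_eq_lintegral_rpow_enorm_toReal hq0 hq, ← ENNReal.rpow_mul]
  congr 1
  · refine lintegral_congr fun s => ?_
    rw [squareFun, enorm_eq_self, ← ENNReal.rpow_mul]
    congr 1; ring
  · ring

lemma measurable_gaussian_combination (u : ℕ → Lp ℝ q ν) (F : Finset ℕ) :
    Measurable (Function.uncurry fun (ω : ℕ → ℝ) (s : α) => ‖∑ n ∈ F, ω n * u n s‖ₑ) := by
  have : ∀ n, Measurable (u n) := fun n => (Lp.stronglyMeasurable (u n)).measurable
  unfold Function.uncurry
  fun_prop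

/-- For `q ≤ 2` the constant `1` works; for `q ≥ 2` it is the `q`-th absolute moment norm of a
standard Gaussian variable. -/
lemma exists_gaussSum_le [SFinite ν] (hq0 : q ≠ 0) (hq : q ≠ ∞) :
    ∃ C : ℝ≥0, ∀ (u : ℕ → Lp ℝ q ν) (F : Finset ℕ),
      eLpNorm (gaussSum u F) 2 gaussianSequence ≤ C * eLpNorm (squareFun u F) q ν := by
  have hr0 : 0 < q.toReal := ENNReal.toReal_pos hq0 hq
  set r := q.toReal
  have hV : ∀ (u : ℕ → Lp ℝ q ν) (F : Finset ℕ), Measurable fun s => ∑ n ∈ F, ‖u n s‖ₑ ^ 2 := by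
    intro u F
    have : ∀ n, Measurable (u n) := fun n => (Lp.stronglyMeasurable (u n)).measurable
    fun_prop
  rcases le_total 2 r with h | h
  · have hc : gaussianMoment r ^ (1 / r) ≠ ∞ :=
      ENNReal.rpow_ne_top_of_nonneg (by positivity) (gaussianMoment_ne_top hr0)
    refine ⟨(gaussianMoment r ^ (1 / r)).toNNReal, fun u F => ?_⟩
    rw [eLpNorm_gaussSum_two hq0 hq, eLpNorm_squareFun hq0 hq, ENNReal.coe_toNNReal hc]
    refine (ENNReal.rpow_le_rpow (lintegral_mixed_le_of_two_le
      (measurable_gaussian_combination u F) h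
      (fun s => lintegral_gaussian_sum (fun n => u n s) F hr0) (hV u F))
      (by positivity)).trans_eq ?_
    rw [ENNReal.mul_rpow_of_nonneg _ _ (by positivity),
      ENNReal.mul_rpow_of_nonneg _ _ (by positivity), ← ENNReal.rpow_mul]
    congr 2; field_simp
  · refine ⟨1, fun u F => ?_⟩
    rw [eLpNorm_gaussSum_two hq0 hq, eLpNorm_squareFun hq0 hq, ENNReal.coe_one, one_mul]
    refine ENNReal.rpow_le_rpow (lintegral_mixed_le_of_le_two
      (measurable_gaussian_combination u F) hr0 h (fun s => ?_) (hV u F) (fun s hs ω => ?_)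
      (fun s => ?_)) (by positivity)
    · rw [lintegral_gaussian_sum (fun n => u n s) F two_pos, gaussianMoment_two]; simp
    · rw [Finset.sum_eq_zero_iff] at hs
      rw [Finset.sum_eq_zero, enorm_zero]
      intro n hn
      have := hs n hn
      simp only [ne_eq, OfNat.ofNat_ne_zero, not_false_eq_true, pow_eq_zero_iff,
        enorm_eq_zero] at this
      rw [this, mul_zero]
    · exact ENNReal.sum_ne_top.2 fun n _ => ENNReal.pow_ne_top enorm_ne_top

lemma eLpNorm_squareFun_ne_top (u : ℕ → Lp ℝ q ν) (F : Finset ℕ) :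
    eLpNorm (squareFun u F) q ν ≠ ∞ := by
  have hle : ∀ s, ‖squareFun u F s‖ₑ ≤ ‖∑ n ∈ F, |u n s|‖ₑ := by
    intro s
    rw [squareFun, enorm_eq_self, Real.enorm_of_nonneg (Finset.sum_nonneg fun n _ => abs_nonneg _),
      ENNReal.ofReal_sum_of_nonneg (fun n _ => abs_nonneg _)]
    simp_rw [← Real.norm_eq_abs, ofReal_norm]
    rw [one_div, ENNReal.rpow_inv_le_iff two_pos, ENNReal.rpow_two]
    classical
    induction F using Finset.induction_on with
    | empty => simp
    | insert m F hm ih =>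
      rw [Finset.sum_insert hm, Finset.sum_insert hm]
      calc ‖u m s‖ₑ ^ 2 + ∑ n ∈ F, ‖u n s‖ₑ ^ 2
          ≤ ‖u m s‖ₑ ^ 2 + (∑ n ∈ F, ‖u n s‖ₑ) ^ 2 := by gcongr
        _ ≤ ‖u m s‖ₑ ^ 2 + (∑ n ∈ F, ‖u n s‖ₑ) ^ 2 + 2 * ‖u m s‖ₑ * (∑ n ∈ F, ‖u n s‖ₑ) :=
            le_self_add
        _ = _ := by ring
  have hm : MemLp (fun s => ∑ n ∈ F, |u n s|) q ν :=
    memLp_finsetSum F fun n _ => (Lp.memLp (u n)).abs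
  exact ((eLpNorm_mono_enorm hle).trans_lt hm.eLpNorm_lt_top).ne

/-- For `q ≥ 2` the constant `1` works; for `q ≤ 2` it is the inverse of the `q`-th absolute moment
norm of a standard Gaussian variable. -/
lemma exists_squareFun_le [SFinite ν] (hq0 : q ≠ 0) (hq : q ≠ ∞) :
    ∃ C : ℝ≥0, C ≠ 0 ∧ ∀ (u : ℕ → Lp ℝ q ν) (F : Finset ℕ),
      eLpNorm (squareFun u F) q ν ≤ C * eLpNorm (gaussSum u F) 2 gaussianSequence := by
  have hr0 : 0 < q.toReal := ENNReal.toReal_pos hq0 hq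
  set r := q.toReal with hr
  have hV : ∀ (u : ℕ → Lp ℝ q ν) (F : Finset ℕ), Measurable fun s => ∑ n ∈ F, ‖u n s‖ₑ ^ 2 := by
    intro u F
    have : ∀ n, Measurable (u n) := fun n => (Lp.stronglyMeasurable (u n)).measurable
    fun_prop
  rcases le_total 2 r with h | h
  · refine ⟨1, one_ne_zero, fun u F => ?_⟩
    have hfin := eLpNorm_squareFun_ne_top u F
    rw [eLpNorm_gaussSum_two hq0 hq, ENNReal.coe_one, one_mul]
    rw [eLpNorm_squareFun hq0 hq] at hfin ⊢
    refine ENNReal.rpow_le_rpow (le_lintegral_mixed_of_two_le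
      (measurable_gaussian_combination u F) h (fun s => ?_) (hV u F) ?_) (by positivity)
    · rw [lintegral_gaussian_sum (fun n => u n s) F two_pos, gaussianMoment_two]; simp
    · intro h'
      rw [← hr, h', ENNReal.top_rpow_of_pos (by positivity),
        ENNReal.top_rpow_of_pos (by positivity)] at hfin
      exact hfin rfl
  · set c := gaussianMoment r ^ (1 / r) with hc
    have hc0 : c ≠ 0 := by simp [c, gaussianMoment_ne_zero hr0, gaussianMoment_ne_top hr0]
    have hct : c ≠ ∞ := ENNReal.rpow_ne_top_of_nonneg (by positivity) (gaussianMoment_ne_top hr0)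
    refine ⟨c⁻¹.toNNReal, ?_, fun u F => ?_⟩
    · rw [Ne, ENNReal.toNNReal_eq_zero_iff, not_or]
      simp [hc0, hct]
    · rw [ENNReal.coe_toNNReal (by simp [hc0]), mul_comm, ← div_eq_mul_inv,
        ENNReal.le_div_iff_mul_le (.inl hc0) (.inl hct), mul_comm, eLpNorm_gaussSum_two hq0 hq,
        eLpNorm_squareFun hq0 hq]
      refine le_trans (le_of_eq ?_) (ENNReal.rpow_le_rpow (le_lintegral_mixed_of_le_two
        (measurable_gaussian_combination u F) hr0 h
        (fun s => lintegral_gaussian_sum (fun n => u n s) F hr0) (hV u F)) (by positivity))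
      rw [ENNReal.mul_rpow_of_nonneg _ _ (by positivity),
        ENNReal.mul_rpow_of_nonneg _ _ (by positivity)]
      congr 1
      rw [hc, ← ENNReal.rpow_mul]
      congr 1
      rw [← hr]
      field_simp

end SquareFunction

/-! ### Orthonormal sequences padded with zeros -/

section ONBSeq

variable {G : Type*} [NormedAddCommGroup G] [InnerProductSpace ℝ G]

lemma countable_of_orthonormal [TopologicalSpace.SeparableSpace G] {ι : Type*} {b : ι → G}
    (ho : Orthonormal ℝ b) : Countable ι := by
  -- Distinct members of an orthonormal family have distance `√2`.
  have hpair : ∀ i j : ι, i ≠ j → 1 ≤ dist (b i) (b j) := by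
    intro i j hij
    have h1 : ‖b i - b j‖ ^ 2 = 2 := by
      rw [@norm_sub_sq_real, ho.1 i, ho.1 j, ho.2 hij]; norm_num
    rw [dist_eq_norm]
    nlinarith [norm_nonneg (b i - b j)]
  have hdisj : Pairwise (Function.onFun Disjoint fun i : ι => Metric.ball (b i) (1 / 2)) := by
    intro i j hij
    refine Metric.ball_disjoint_ball ?_
    have := hpair i j hij
    linarith
  exact Pairwise.countable_of_isOpen_disjoint hdisj (fun _ => Metric.isOpen_ball)
    (fun i => ⟨b i, Metric.mem_ball_self (by norm_num)⟩)

lemma exists_isONBSeq [CompleteSpace G] [TopologicalSpace.SeparableSpace G] :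
    ∃ h : ℕ → G, IsONBSeq h := by
  obtain ⟨w, b, hb⟩ := exists_hilbertBasis ℝ G
  have ho : Orthonormal ℝ b := b.orthonormal
  have hw : Countable w := countable_of_orthonormal ho
  obtain ⟨f, hf⟩ := exists_injective_nat w
  classical
  let h : ℕ → G := fun n => if hn : ∃ i, f i = n then b hn.choose else 0
  have h1 : ∀ i, h (f i) = b i := by
    intro i
    have hi : ∃ j, f j = f i := ⟨i, rfl⟩
    simp only [h, dif_pos hi]
    rw [hf hi.choose_spec]
  have h2 : ∀ n, h n = 0 ∨ ∃ i, f i = n ∧ h n = b i := by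
    intro n
    by_cases hn : ∃ i, f i = n
    · obtain ⟨i, rfl⟩ := hn
      exact .inr ⟨i, rfl, h1 i⟩
    · exact .inl (by simp only [h, dif_neg hn])
  refine ⟨h, ⟨fun m n hmn => ?_, fun n => ?_, ?_⟩⟩
  · rcases h2 m with h0 | ⟨i, hi, hi'⟩
    · rw [h0, inner_zero_left]
    · rcases h2 n with h0 | ⟨j, hj, hj'⟩
      · rw [h0, inner_zero_right]
      · rw [hi', hj']
        refine ho.2 ?_
        rintro rfl
        exact hmn (hi.symm.trans hj)
  · rcases h2 n with h0 | ⟨i, -, hi⟩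
    · exact .inl h0
    · exact .inr (hi ▸ ho.1 i)
  · rw [eq_top_iff, ← b.dense_span]
    refine Submodule.topologicalClosure_mono (Submodule.span_mono ?_)
    rintro _ ⟨i, rfl⟩
    exact ⟨f i, h1 i⟩

variable {h : ℕ → G}

lemma IsONBSeq.orthonormal (hh : IsONBSeq h) :
    Orthonormal ℝ (fun n : {n // h n ≠ 0} => h n) :=
  ⟨fun n => (hh.norm_eq n).resolve_left n.2,
    fun m n hmn => hh.orthogonal m n (Subtype.coe_ne_coe.2 hmn)⟩

variable [CompleteSpace G]

/-- The Hilbert basis formed by the nonzero members of the sequence. -/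
def IsONBSeq.hilbertBasis (hh : IsONBSeq h) : HilbertBasis {n // h n ≠ 0} ℝ G :=
  HilbertBasis.mk hh.orthonormal (by
    rw [← hh.dense]
    refine Submodule.topologicalClosure_mono (Submodule.span_le.2 ?_)
    rintro _ ⟨n, rfl⟩
    by_cases hn : h n = 0
    · rw [hn]; exact Submodule.zero_mem _
    · exact Submodule.subset_span ⟨⟨n, hn⟩, rfl⟩)

lemma IsONBSeq.hilbertBasis_apply (hh : IsONBSeq h) (n : {n // h n ≠ 0}) :
    hh.hilbertBasis n = h n := by
  rw [IsONBSeq.hilbertBasis, HilbertBasis.coe_mk]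

lemma IsONBSeq.hasSum_repr (hh : IsONBSeq h) (x : G) :
    HasSum (fun n => inner ℝ (h n) x • h n) x := by
  have h1 := hh.hilbertBasis.hasSum_repr x
  simp_rw [HilbertBasis.repr_apply_apply, hh.hilbertBasis_apply] at h1
  refine (hasSum_subtype_iff_of_support_subset (s := {n | h n ≠ 0}) ?_).1 h1
  intro n hn h0
  exact hn (by simp [h0])

lemma IsONBSeq.hasSum_inner_mul_inner (hh : IsONBSeq h) (x y : G) :
    HasSum (fun n => inner ℝ x (h n) * inner ℝ (h n) y) (inner ℝ x y) := by
  have h1 := hh.hilbertBasis.hasSum_inner_mul_inner x y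
  simp_rw [hh.hilbertBasis_apply] at h1
  refine (hasSum_subtype_iff_of_support_subset (s := {n | h n ≠ 0})
    (f := fun n => inner ℝ x (h n) * inner ℝ (h n) y) ?_).1 h1
  intro n hn h0
  exact hn (by simp [h0])

lemma IsONBSeq.tsum_enorm_inner_sq (hh : IsONBSeq h) (x : G) :
    ∑' n, ‖(inner ℝ x (h n) : ℝ)‖ₑ ^ 2 = ‖x‖ₑ ^ 2 := by
  have h1 := hh.hasSum_inner_mul_inner x x
  have h2 : ∀ n, inner ℝ x (h n) * inner ℝ (h n) x = ‖(inner ℝ x (h n) : ℝ)‖ ^ 2 := by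
    intro n
    rw [real_inner_comm x (h n), Real.norm_eq_abs, sq_abs, sq]
  simp_rw [h2] at h1
  have h3 := ENNReal.ofReal_tsum_of_nonneg (fun n => sq_nonneg _) h1.summable
  rw [h1.tsum_eq, real_inner_self_eq_norm_sq, ENNReal.ofReal_pow (norm_nonneg _),
    ofReal_norm] at h3
  rw [h3]
  refine tsum_congr fun n => ?_
  rw [ENNReal.ofReal_pow (norm_nonneg _), ofReal_norm]

/-- Riesz–Fischer: square summable coefficients are the coefficients of a vector. -/
lemma IsONBSeq.exists_inner_eq (hh : IsONBSeq h) {v : ℕ → ℝ}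
    (hv : ∑' n, ‖v n‖ₑ ^ 2 ≠ ∞) (h0 : ∀ n, h n = 0 → v n = 0) :
    ∃ g : G, ∀ n, inner ℝ (h n) g = v n := by
  have hs : Summable fun n => ‖v n‖ ^ 2 := by
    have := ENNReal.summable_toReal hv
    simpa using this
  have hm : Memℓp (fun n : {n // h n ≠ 0} => v n) 2 := by
    rw [memℓp_gen_iff (by norm_num)]
    simp only [ENNReal.toReal_ofNat, Real.rpow_two]
    exact hs.subtype {n | h n ≠ 0}
  refine ⟨hh.hilbertBasis.repr.symm ⟨_, hm⟩, fun n => ?_⟩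
  by_cases hn : h n = 0
  · rw [hn, inner_zero_left, h0 n hn]
  · have := hh.hilbertBasis.repr_apply_apply (hh.hilbertBasis.repr.symm ⟨_, hm⟩) ⟨n, hn⟩
    rw [hh.hilbertBasis_apply, LinearIsometryEquiv.apply_symm_apply] at this
    exact this.symm

end ONBSeq

/-! ### Gaussian series in `L^q` -/

section GaussianSeries

variable {α : Type*} [MeasurableSpace α] {ν : Measure α} {q : ℝ≥0∞} [Fact (1 ≤ q)]

lemma continuous_gaussSum (u : ℕ → Lp ℝ q ν) (F : Finset ℕ) :
    Continuous (gaussSum u F) := by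
  unfold gaussSum; fun_prop

lemma memLp_gaussSum [SFinite ν] (hq : q ≠ ∞) (u : ℕ → Lp ℝ q ν) (F : Finset ℕ) :
    MemLp (gaussSum u F) 2 gaussianSequence := by
  have hq0 : q ≠ 0 := (zero_lt_one.trans_le Fact.out).ne'
  refine ⟨(continuous_gaussSum u F).aestronglyMeasurable, ?_⟩
  obtain ⟨C, hC⟩ := exists_gaussSum_le (ν := ν) hq0 hq
  exact (hC u F).trans_lt (ENNReal.mul_lt_top ENNReal.coe_lt_top
    (eLpNorm_squareFun_ne_top u F).lt_top)

/-- If the operator `R` is given by a kernel `Ψ` with values in the Hilbert space, then its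
Gaussian series converges, with norm controlled by the `L^q`-norm of `‖Ψ‖`. -/
lemma exists_isGaussianLimit_le [SFinite ν] (hq : q ≠ ∞) : ∃ C : ℝ≥0,
    ∀ (G : Type*) [NormedAddCommGroup G] [InnerProductSpace ℝ G] [CompleteSpace G]
      (R : G →L[ℝ] Lp ℝ q ν) (h : ℕ → G) (Ψ : α → G) (ρ : α → ℝ≥0∞), IsONBSeq h →
      (∀ g, R g =ᵐ[ν] fun s => inner ℝ (Ψ s) g) → (∀ᵐ s ∂ν, ‖Ψ s‖ₑ ≤ ρ s) →
      eLpNorm ρ q ν ≠ ∞ →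
      ∃ ζ, IsGaussianLimit R h ζ ∧ eLpNorm ζ 2 gaussianSequence ≤ C * eLpNorm ρ q ν := by
  have hq0 : q ≠ 0 := (zero_lt_one.trans_le Fact.out).ne'
  have hr0 : 0 < q.toReal := ENNReal.toReal_pos hq0 hq
  obtain ⟨C, hC⟩ := exists_gaussSum_le (ν := ν) hq0 hq
  refine ⟨C, fun G _ _ _ R h Ψ ρ hh hR hρ hρt => ?_⟩
  set u : ℕ → Lp ℝ q ν := fun n => R (h n) with hu
  have hum : ∀ n, Measurable (u n) := fun n => (Lp.stronglyMeasurable (u n)).measurable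
  have hR' : ∀ᵐ s ∂ν, ∀ n, u n s = inner ℝ (Ψ s) (h n) := ae_all_iff.2 fun n => hR (h n)
  -- The tails of the square function dominate the Gaussian sums and tend to zero in `L^q`.
  let tail : ℕ → α → ℝ≥0∞ := fun M s => (∑' n, ‖u (n + M) s‖ₑ ^ 2) ^ (1 / 2 : ℝ)
  have htail_meas : ∀ M, Measurable (tail M) := fun M => by
    have : ∀ n, Measurable fun s => ‖u (n + M) s‖ₑ ^ 2 := fun n => by fun_prop
    exact (Measurable.tsum this).pow_const _
  have htail0 : ∀ᵐ s ∂ν, tail 0 s ≤ ρ s := by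
    filter_upwards [hR', hρ] with s hs hs'
    refine le_trans (le_of_eq ?_) hs'
    simp only [tail, add_zero, hs, hh.tsum_enorm_inner_sq]
    rw [← ENNReal.rpow_two, ← ENNReal.rpow_mul]
    norm_num
  have htail_le : ∀ M s, tail M s ≤ tail 0 s := by
    intro M s
    refine ENNReal.rpow_le_rpow ?_ (by norm_num)
    exact ENNReal.tsum_comp_le_tsum_of_injective (add_left_injective M)
      (fun n => ‖u n s‖ₑ ^ 2)
  have htail0_top : eLpNorm (tail 0) q ν ≠ ∞ :=
    ((eLpNorm_mono_enorm_ae (by simpa using htail0)).trans_lt hρt.lt_top).ne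
  have htail0_int : ∫⁻ s, tail 0 s ^ q.toReal ∂ν ≠ ∞ := by
    have := (eLpNorm_lt_top_iff_lintegral_rpow_enorm_lt_top hq0 hq).1 htail0_top.lt_top
    simpa using this.ne
  have htail_lim : Tendsto (fun M => eLpNorm (tail M) q ν) atTop (𝓝 0) := by
    have h1 : Tendsto (fun M => ∫⁻ s, tail M s ^ q.toReal ∂ν) atTop (𝓝 (∫⁻ _, 0 ∂ν)) := by
      refine tendsto_lintegral_of_dominated_convergence (fun s => tail 0 s ^ q.toReal)
        (fun M => (htail_meas M).pow_const _)
        (fun M => Eventually.of_forall fun s => ENNReal.rpow_le_rpow (htail_le M s) hr0.le)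
        htail0_int ?_
      filter_upwards [hR'] with s hs
      have ht : ∑' n, ‖u n s‖ₑ ^ 2 ≠ ∞ := by
        simp only [hs, hh.tsum_enorm_inner_sq]
        exact ENNReal.pow_ne_top enorm_ne_top
      have h2 := ENNReal.tendsto_sum_nat_add (fun n => ‖u n s‖ₑ ^ 2) ht
      have h3 := (h2.ennrpow_const (1 / 2 : ℝ)).ennrpow_const q.toReal
      simpa [hr0, tail] using h3
    have h4 := h1.ennrpow_const (1 / q.toReal)
    simp only [lintegral_zero] at h4
    rw [ENNReal.zero_rpow_of_pos (by positivity)] at h4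
    refine h4.congr fun M => ?_
    rw [eLpNorm_eq_lintegral_rpow_enorm_toReal hq0 hq]
    simp
  have hsq : ∀ M N, M ≤ N → eLpNorm (gaussianSum R h N - gaussianSum R h M) 2 gaussianSequence ≤
      C * eLpNorm (tail M) q ν := by
    intro M N hMN
    have e : gaussianSum R h N - gaussianSum R h M = gaussSum u (Finset.Ico M N) := by
      ext1 ω
      simp only [Pi.sub_apply, gaussianSum, gaussSum, Finset.sum_Ico_eq_sub _ hMN]
      rfl
    rw [e]
    refine (hC u _).trans ?_
    gcongr
    refine eLpNorm_mono_enorm fun s => ?_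
    simp only [enorm_eq_self, squareFun, tail]
    refine ENNReal.rpow_le_rpow ?_ (by norm_num)
    rw [Finset.sum_Ico_eq_sum_range]
    simp_rw [add_comm M]
    exact ENNReal.sum_le_tsum (f := fun n => ‖u (n + M) s‖ₑ ^ 2) _
  have hmem : ∀ N, MemLp (gaussianSum R h N) 2 gaussianSequence := fun N =>
    memLp_gaussSum hq u (Finset.range N)
  let Z : ℕ → Lp (Lp ℝ q ν) 2 gaussianSequence := fun N => (hmem N).toLp _
  have hcau : CauchySeq Z := by
    have hlim : Tendsto (fun M => (2 * C * eLpNorm (tail M) q ν)) atTop (𝓝 0) := by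
      have := ENNReal.Tendsto.const_mul (a := 2 * (C : ℝ≥0∞)) htail_lim
        (.inr (ENNReal.mul_ne_top (by simp) ENNReal.coe_ne_top))
      simpa using this
    rw [EMetric.cauchySeq_iff]
    intro ε hε
    obtain ⟨M, hM⟩ := ((tendsto_order.1 hlim).2 ε hε).exists
    refine ⟨M, fun m hm n hn => lt_of_le_of_lt ?_ hM⟩
    have hd : ∀ N, M ≤ N → edist (Z N) (Z M) ≤ C * eLpNorm (tail M) q ν := by
      intro N hN
      rw [Lp.edist_toLp_toLp]
      exact hsq M N hN
    calc edist (Z m) (Z n) ≤ edist (Z m) (Z M) + edist (Z n) (Z M) := by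
          rw [edist_comm (Z n)]; exact edist_triangle _ _ _
      _ ≤ C * eLpNorm (tail M) q ν + C * eLpNorm (tail M) q ν := add_le_add (hd m hm) (hd n hn)
      _ = _ := by ring
  obtain ⟨z, hz⟩ := cauchySeq_tendsto_of_complete hcau
  have hz' := (Lp.tendsto_Lp_iff_tendsto_eLpNorm'' _ hmem z (Lp.memLp z)).1
    (by simpa [Z] using hz)
  refine ⟨z, ⟨hh, Lp.memLp z, hz'⟩, ?_⟩
  have hb : ∀ N, eLpNorm z 2 gaussianSequence ≤
      eLpNorm (gaussianSum R h N - ⇑z) 2 gaussianSequence + C * eLpNorm ρ q ν := by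
    intro N
    calc eLpNorm z 2 gaussianSequence
        = eLpNorm ((⇑z - gaussianSum R h N) + gaussianSum R h N) 2 gaussianSequence := by
          rw [sub_add_cancel]
      _ ≤ eLpNorm (⇑z - gaussianSum R h N) 2 gaussianSequence +
            eLpNorm (gaussianSum R h N) 2 gaussianSequence :=
          eLpNorm_add_le ((Lp.memLp z).sub (hmem N)).aestronglyMeasurable
            (hmem N).aestronglyMeasurable (by norm_num)
      _ ≤ _ := by
          rw [eLpNorm_sub_comm]
          gcongr
          have h5 := hsq 0 N (Nat.zero_le N)
          have h6 : gaussianSum R h 0 = 0 := by ext1 ω; simp [gaussianSum]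
          rw [h6, sub_zero] at h5
          refine h5.trans ?_
          gcongr
          exact eLpNorm_mono_enorm_ae (by simpa using htail0)
  have := ge_of_tendsto' (hz'.add_const (C * eLpNorm ρ q ν)) hb
  rwa [zero_add] at this

/-- Conversely, the Gaussian series of an operator into `L^q` controls its square function
`(∑ₙ |R hₙ|²)^(1/2)`. -/
lemma exists_squareFun_le_of_isGaussianLimit [SFinite ν] (hq : q ≠ ∞) : ∃ C : ℝ≥0, C ≠ 0 ∧
    ∀ (G : Type*) [NormedAddCommGroup G] [InnerProductSpace ℝ G] (R : G →L[ℝ] Lp ℝ q ν)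
      (h : ℕ → G) (ζ : (ℕ → ℝ) → Lp ℝ q ν), IsGaussianLimit R h ζ →
      eLpNorm (fun s => (∑' n, ‖R (h n) s‖ₑ ^ 2) ^ (1 / 2 : ℝ)) q ν ≤
        C * eLpNorm ζ 2 gaussianSequence := by
  have hq0 : q ≠ 0 := (zero_lt_one.trans_le Fact.out).ne'
  have hr0 : 0 < q.toReal := ENNReal.toReal_pos hq0 hq
  obtain ⟨C, hC0, hC⟩ := exists_squareFun_le (ν := ν) hq0 hq
  refine ⟨C, hC0, fun G _ _ R h ζ hζ => ?_⟩
  set u : ℕ → Lp ℝ q ν := fun n => R (h n) with hu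
  have h1 : ∀ N, eLpNorm (squareFun u (Finset.range N)) q ν ≤
      C * (eLpNorm (gaussianSum R h N - ζ) 2 gaussianSequence +
        eLpNorm ζ 2 gaussianSequence) := by
    intro N
    refine (hC u _).trans ?_
    gcongr
    calc eLpNorm (gaussSum u (Finset.range N)) 2 gaussianSequence
        = eLpNorm ((gaussianSum R h N - ζ) + ζ) 2 gaussianSequence := by
          rw [sub_add_cancel]; rfl
      _ ≤ _ := eLpNorm_add_le
          ((memLp_gaussSum hq u (Finset.range N)).sub hζ.memLp).aestronglyMeasurable
          hζ.memLp.aestronglyMeasurable (by norm_num)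
  have h2 : Tendsto (fun N => C * (eLpNorm (gaussianSum R h N - ζ) 2 gaussianSequence +
        eLpNorm ζ 2 gaussianSequence)) atTop (𝓝 (C * eLpNorm ζ 2 gaussianSequence)) := by
    have := ENNReal.Tendsto.const_mul (a := (C : ℝ≥0∞))
      (hζ.tendsto.add_const (eLpNorm ζ 2 gaussianSequence)) (.inr ENNReal.coe_ne_top)
    rwa [zero_add] at this
  have h3 : Tendsto (fun N => eLpNorm (squareFun u (Finset.range N)) q ν) atTop
      (𝓝 (eLpNorm (fun s => (∑' n, ‖u n s‖ₑ ^ 2) ^ (1 / 2 : ℝ)) q ν)) := by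
    simp_rw [eLpNorm_eq_lintegral_rpow_enorm_toReal hq0 hq, enorm_eq_self]
    refine Tendsto.ennrpow_const _ ?_
    refine lintegral_tendsto_of_tendsto_of_monotone
      (fun N => ((measurable_squareFun u _).pow_const _).aemeasurable) ?_ ?_
    · refine Eventually.of_forall fun s M N hMN => ?_
      simp only [squareFun]
      gcongr
    · refine Eventually.of_forall fun s => ?_
      simp only [squareFun]
      exact ((ENNReal.tendsto_nat_tsum fun n => ‖u n s‖ₑ ^ 2).ennrpow_const _).ennrpow_const _
  exact le_of_tendsto_of_tendsto' h3 h2 h1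

end GaussianSeries

/-! ### Measurability of functions with values in `L^q` -/

section JointMeasurability

/-- Measurability is tested on closed sets, which are zero sets of countable infima of
distances. -/
lemma measurable_of_measurable_edist {A E : Type*} [MeasurableSpace A] [PseudoEMetricSpace E]
    [SecondCountableTopology E] [MeasurableSpace E] [BorelSpace E] {f : A → E}
    (hf : ∀ u, Measurable fun a => edist (f a) u) : Measurable f := by
  refine measurable_of_isClosed fun K hK => ?_
  rcases K.eq_empty_or_nonempty with rfl | hne
  · simp
  have : Nonempty K := hne.to_subtype
  let d : ℕ → K := TopologicalSpace.denseSeq K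
  have hd : closure (range fun n => (d n : E)) = K := by
    have h1 : (range fun n => (d n : E)) = Subtype.val '' range d := by
      rw [← range_comp]; rfl
    apply Subset.antisymm
    · refine closure_minimal ?_ hK
      rintro _ ⟨n, rfl⟩
      exact (d n).2
    · rw [h1]
      have h2 := image_closure_subset_closure_image (f := (Subtype.val : K → E))
        continuous_subtype_val (s := range d)
      rw [(TopologicalSpace.denseRange_denseSeq K).closure_range, image_univ,
        Subtype.range_coe] at h2
      exact h2
  have h3 : f ⁻¹' K = {a | ⨅ n, edist (f a) (d n) = 0} := by
    ext a
    have h4 : Metric.infEDist (f a) K = ⨅ n, edist (f a) (d n) := by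
      rw [← congrArg (Metric.infEDist (f a)) hd, Metric.infEDist_closure, Metric.infEDist,
        iInf_range]
    rw [mem_preimage, mem_ofPred_eq, Metric.mem_iff_infEDist_zero_of_closed hK, h4]
  rw [h3]
  exact (Measurable.iInf fun n => hf _) (measurableSet_singleton 0)

variable {A α : Type*} {mA : MeasurableSpace A} [MeasurableSpace α] {ν : Measure α}
  [IsSeparable ν] {q : ℝ≥0∞} [Fact (1 ≤ q)]

lemma stronglyMeasurable_toLp [SFinite ν] (hq : q ≠ ∞) {F : A → α → ℝ}
    (hF : Measurable (Function.uncurry F)) (hmem : ∀ a, MemLp (F a) q ν) :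
    StronglyMeasurable fun a => (hmem a).toLp (F a) := by
  have hq0 : q ≠ 0 := (zero_lt_one.trans_le Fact.out).ne'
  have : Fact (q ≠ ∞) := ⟨hq⟩
  borelize ↥(Lp ℝ q ν)
  refine Measurable.stronglyMeasurable (measurable_of_measurable_edist fun u => ?_)
  have hu : Measurable u := (Lp.stronglyMeasurable u).measurable
  have h1 : ∀ a, edist ((hmem a).toLp (F a)) u =
      (∫⁻ s, ‖F a s - u s‖ₑ ^ q.toReal ∂ν) ^ (1 / q.toReal) := by
    intro a
    conv_lhs => rw [← Lp.toLp_coeFn u (Lp.memLp u)]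
    rw [Lp.edist_toLp_toLp, eLpNorm_eq_lintegral_rpow_enorm_toReal hq0 hq]
    rfl
  simp_rw [h1]
  refine Measurable.pow_const ?_ _
  have h2 : Measurable fun p : A × α => ‖F p.1 p.2 - u p.2‖ₑ ^ q.toReal :=
    ((hF.sub (hu.comp measurable_snd)).enorm).pow_const _
  exact h2.lintegral_prod_right'

/-- A strongly measurable function with values in `L^q` has a jointly measurable representative:
a measurable selection from a countable dense set approximates it fast enough for pointwise
convergence. -/
lemma exists_measurable_representative (hq : q ≠ ∞) {μ : Measure A} {Θ : A → Lp ℝ q ν}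
    (hΘ : AEStronglyMeasurable Θ μ) :
    ∃ θ : A × α → ℝ, Measurable θ ∧ ∀ᵐ t ∂μ, (Θ t : α → ℝ) =ᵐ[ν] fun s => θ (t, s) := by
  have hq0 : q ≠ 0 := (zero_lt_one.trans_le Fact.out).ne'
  have hr0 : 0 < q.toReal := ENNReal.toReal_pos hq0 hq
  have : Fact (q ≠ ∞) := ⟨hq⟩
  set Θ' := hΘ.mk Θ with hΘ'
  have hm : StronglyMeasurable Θ' := hΘ.stronglyMeasurable_mk
  let d : ℕ → Lp ℝ q ν := TopologicalSpace.denseSeq (Lp ℝ q ν)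
  let ε : ℕ → ℝ≥0∞ := fun n => (2⁻¹ ^ n : ℝ≥0∞) ^ (1 / q.toReal)
  have hε : ∀ n, 0 < ε n := fun n => by
    refine ENNReal.rpow_pos (pos_iff_ne_zero.2 (pow_ne_zero _ (by simp))) ?_
    exact ENNReal.pow_ne_top (by simp)
  have hex : ∀ n a, ∃ k, edist (Θ' a) (d k) < ε n := by
    intro n a
    obtain ⟨y, hy, hy'⟩ := (EMetric.mem_closure_iff.1
      ((TopologicalSpace.denseRange_denseSeq (Lp ℝ q ν)) (Θ' a))) (ε n) (hε n)
    obtain ⟨k, rfl⟩ := hy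
    exact ⟨k, hy'⟩
  classical
  let κ : ℕ → A → ℕ := fun n a => Nat.find (hex n a)
  have hκ : ∀ n, Measurable (κ n) := by
    intro n
    refine measurable_find (hex n) fun k => ?_
    have h1 : StronglyMeasurable fun a => edist (Θ' a) (d k) := hm.edist stronglyMeasurable_const
    exact measurableSet_lt h1.measurable measurable_const
  let θn : ℕ → A × α → ℝ := fun n p => d (κ n p.1) p.2
  have hθn : ∀ n, Measurable (θn n) := by
    intro n
    have h1 : Measurable fun p : ℕ × α => d p.1 p.2 :=
      measurable_from_prod_countable_right fun k => (Lp.stronglyMeasurable (d k)).measurable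
    exact h1.comp ((((hκ n).comp measurable_fst)).prodMk measurable_snd)
  refine ⟨fun p => limUnder atTop fun n => θn n p,
    (StronglyMeasurable.limUnder fun n => (hθn n).stronglyMeasurable).measurable, ?_⟩
  filter_upwards [hΘ.ae_eq_mk] with t ht
  rw [ht]
  have hsum : ∫⁻ s, ∑' n, ‖θn n (t, s) - Θ' t s‖ₑ ^ q.toReal ∂ν ≠ ∞ := by
    have hmeas : ∀ n, AEMeasurable (fun s => ‖θn n (t, s) - Θ' t s‖ₑ ^ q.toReal) ν := by
      intro n
      have h1 : Measurable fun s => θn n (t, s) := (hθn n).comp measurable_prodMk_left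
      have h2 : Measurable (Θ' t) := (Lp.stronglyMeasurable (Θ' t)).measurable
      fun_prop
    rw [lintegral_tsum hmeas]
    refine ne_top_of_le_ne_top (b := ∑' n, (2⁻¹ : ℝ≥0∞) ^ n) ?_ (ENNReal.tsum_le_tsum fun n => ?_)
    · rw [ENNReal.tsum_geometric]
      simp
    · have h1 : edist (Θ' t) (d (κ n t)) < ε n := Nat.find_spec (hex n t)
      rw [edist_comm] at h1
      rw [← Lp.toLp_coeFn (d (κ n t)) (Lp.memLp _), ← Lp.toLp_coeFn (Θ' t) (Lp.memLp _),
        Lp.edist_toLp_toLp, eLpNorm_eq_lintegral_rpow_enorm_toReal hq0 hq] at h1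
      exact ((ENNReal.rpow_lt_rpow_iff (by positivity)).1 h1).le
  filter_upwards [ae_lt_top' (AEMeasurable.tsum fun n => by
    have h1 : Measurable fun s => θn n (t, s) := (hθn n).comp measurable_prodMk_left
    have h2 : Measurable (Θ' t) := (Lp.stronglyMeasurable (Θ' t)).measurable
    fun_prop) hsum] with s hs
  have h1 := ENNReal.tendsto_atTop_zero_of_tsum_ne_top hs.ne
  have h2 := h1.ennrpow_const (1 / q.toReal)
  simp_rw [← ENNReal.rpow_mul, mul_one_div_cancel hr0.ne', ENNReal.rpow_one] at h2
  rw [ENNReal.zero_rpow_of_pos (by positivity)] at h2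
  refine (Tendsto.limUnder_eq ?_).symm
  rw [tendsto_iff_edist_tendsto_0]
  simpa [edist_eq_enorm_sub] using h2

end JointMeasurability

/-! ### Functions in `γ(μ; L^q)` have square integrable sections -/

section SquareIntegrable

variable {A α : Type*} [MeasurableSpace A] [MeasurableSpace α] {μ : Measure A}
  {ν : Measure α} {q : ℝ≥0∞} [Fact (1 ≤ q)]

/-- The limit in `L^q` agrees almost everywhere with any pointwise limit. -/
lemma ae_eq_of_tendsto_Lp {E : Type*} [NormedAddCommGroup E] {F : ℕ → Lp E q ν} {f : Lp E q ν}
    (hF : Tendsto F atTop (𝓝 f)) :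
    ∀ᵐ s ∂ν, ∀ y, Tendsto (fun n => F n s) atTop (𝓝 y) → f s = y := by
  obtain ⟨ns, hns, h⟩ := (tendstoInMeasure_of_tendsto_Lp hF).exists_seq_tendsto_ae
  filter_upwards [h] with s hs y hy
  exact tendsto_nhds_unique hs (hy.comp hns.tendsto_atTop)

/-- Integrable functions with equal integrals over a generating algebra of sets agree. -/
lemma ae_eq_of_setIntegral_eq_of_isSetAlgebra [IsFiniteMeasure μ] {𝒜 : Set (Set A)}
    (h𝒜 : IsSetAlgebra 𝒜) (hgen : ‹MeasurableSpace A› = MeasurableSpace.generateFrom 𝒜)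
    {f g : A → ℝ} (hf : Integrable f μ) (hg : Integrable g μ)
    (h : ∀ C ∈ 𝒜, ∫ t in C, f t ∂μ = ∫ t in C, g t ∂μ) : f =ᵐ[μ] g := by
  have huniv : ∫ t, f t ∂μ = ∫ t, g t ∂μ := by
    simpa using h univ h𝒜.univ_mem
  refine hf.ae_eq_of_forall_setIntegral_eq _ _ hg fun C hC _ => ?_
  induction C, hC using MeasurableSpace.induction_on_inter hgen
    (fun s hs t ht _ => h𝒜.inter_mem hs ht) with
  | empty => simp
  | basic C hC => exact h C hC
  | compl C hC ih =>
    have h1 := integral_add_compl hC hf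
    have h2 := integral_add_compl hC hg
    linarith [ih (measure_lt_top _ _)]
  | iUnion C hd hC ih =>
    rw [integral_iUnion hC hd hf.integrableOn, integral_iUnion hC hd hg.integrableOn]
    exact tsum_congr fun n => ih n (measure_lt_top _ _)

variable [IsFiniteMeasure ν]

variable (ν q) in
lemma exists_eLpNorm_one_le : ∃ c : ℝ≥0, ∀ f : Lp ℝ q ν,
    eLpNorm f 1 ν ≤ c * ‖f‖ₑ := by
  have hq1 : (1 : ℝ≥0∞) ≤ q := Fact.out
  set c : ℝ≥0∞ := ν univ ^ (1 / (1 : ℝ≥0∞).toReal - 1 / q.toReal) with hc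
  have hct : c ≠ ∞ := by
    refine ENNReal.rpow_ne_top_of_nonneg ?_ (measure_ne_top _ _)
    by_cases hq : q = ∞
    · simp [hq]
    · have : 1 ≤ q.toReal := (ENNReal.toReal_mono hq hq1)
      rw [sub_nonneg]
      simpa using inv_le_one_of_one_le₀ this
  refine ⟨c.toNNReal, fun f => ?_⟩
  rw [ENNReal.coe_toNNReal hct, mul_comm, Lp.enorm_def]
  exact eLpNorm_le_eLpNorm_mul_rpow_measure_univ hq1 (Lp.aestronglyMeasurable f)

lemma integrable_representative [SFinite μ] {Θ : A → Lp ℝ q ν} (hΘ : Integrable Θ μ)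
    {θ : A × α → ℝ} (hθ : Measurable θ)
    (hrep : ∀ᵐ t ∂μ, (Θ t : α → ℝ) =ᵐ[ν] fun s => θ (t, s)) :
    Integrable θ (μ.prod ν) := by
  obtain ⟨c, hc⟩ := exists_eLpNorm_one_le ν q
  refine ⟨hθ.aestronglyMeasurable, ?_⟩
  rw [HasFiniteIntegral, lintegral_prod _ hθ.enorm.aemeasurable]
  have h1 : ∫⁻ t, ∫⁻ s, ‖θ (t, s)‖ₑ ∂ν ∂μ ≤ ∫⁻ t, c * ‖Θ t‖ₑ ∂μ := by
    refine lintegral_mono_ae ?_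
    filter_upwards [hrep] with t ht
    refine le_trans (le_of_eq ?_) (hc (Θ t))
    rw [eLpNorm_congr_ae ht, eLpNorm_one_eq_lintegral_enorm]
  refine h1.trans_lt ?_
  rw [lintegral_const_mul' _ _ ENNReal.coe_ne_top]
  exact ENNReal.mul_lt_top ENNReal.coe_lt_top hΘ.2

variable (ν q) in
/-- Integration over a set, as a continuous functional on `L^q`. -/
def setIntegralCLM (B : Set α) : Lp ℝ q ν →L[ℝ] ℝ :=
  LinearMap.mkContinuousOfExistsBound
    { toFun := fun f => ∫ s in B, f s ∂ν
      map_add' := fun f g => by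
        have hi : ∀ f : Lp ℝ q ν, IntegrableOn f B ν := fun f =>
          ((Lp.memLp f).integrable Fact.out).integrableOn
        rw [← integral_add (hi f) (hi g)]
        exact integral_congr_ae (ae_restrict_of_ae (Lp.coeFn_add f g))
      map_smul' := fun c f => by
        rw [RingHom.id_apply, smul_eq_mul, ← integral_const_mul]
        exact integral_congr_ae (ae_restrict_of_ae (Lp.coeFn_smul c f)) }
    (by
      obtain ⟨c, hc⟩ := exists_eLpNorm_one_le ν q
      refine ⟨c, fun f => ?_⟩
      have h1 : ‖∫ s in B, f s ∂ν‖ₑ ≤ c * ‖f‖ₑ := by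
        refine (enorm_integral_le_lintegral_enorm _).trans (le_trans ?_ (hc f))
        rw [eLpNorm_one_eq_lintegral_enorm]
        exact lintegral_mono' Measure.restrict_le_self le_rfl
      have h2 := ENNReal.toReal_mono (ENNReal.mul_ne_top ENNReal.coe_ne_top enorm_ne_top) h1
      simpa using h2)

lemma setIntegralCLM_apply (B : Set α) (f : Lp ℝ q ν) :
    setIntegralCLM ν q B f = ∫ s in B, f s ∂ν := rfl

/-- The Bochner integral in `L^q` is the pointwise integral of a representative. -/
lemma coeFn_integral [SFinite μ] {Ξ : A → Lp ℝ q ν} (hΞ : Integrable Ξ μ) {ξ : A × α → ℝ}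
    (hξ : Measurable ξ) (hrep : ∀ᵐ t ∂μ, (Ξ t : α → ℝ) =ᵐ[ν] fun s => ξ (t, s)) :
    (∫ t, Ξ t ∂μ : Lp ℝ q ν) =ᵐ[ν] fun s => ∫ t, ξ (t, s) ∂μ := by
  have hξi := integrable_representative hΞ hξ hrep
  refine Integrable.ae_eq_of_forall_setIntegral_eq _ _ ((Lp.memLp _).integrable Fact.out)
    hξi.integral_prod_right fun B hB _ => ?_
  rw [← setIntegralCLM_apply, ← ContinuousLinearMap.integral_comp_comm _ hΞ]
  have h1 : ∫ t, setIntegralCLM ν q B (Ξ t) ∂μ = ∫ t, ∫ s in B, ξ (t, s) ∂ν ∂μ := by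
    refine integral_congr_ae ?_
    filter_upwards [hrep] with t ht
    exact integral_congr_ae (ae_restrict_of_ae ht)
  rw [h1]
  refine integral_integral_swap ?_
  have := hξi.restrict (s := univ ×ˢ B)
  rwa [← Measure.prod_restrict, Measure.restrict_univ] at this

/-- If `Θ : A → L^q` represents a `γ`-radonifying operator, tested against integrals over sets,
then almost all sections `θ(·, s)` of a representative lie in `L²(μ)`. They are identified there
through their coefficients in the given basis: both functions have the same integrals over a
countable algebra of sets that generates the `σ`-algebra. -/
lemma ae_lintegral_sq_le_tsum [IsFiniteMeasure μ] [MeasurableSpace.CountablyGenerated A]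
    {Θ : A → Lp ℝ q ν} (hΘ : MemLp Θ 2 μ) {θ : A × α → ℝ} (hθ : Measurable θ)
    (hrep : ∀ᵐ t ∂μ, (Θ t : α → ℝ) =ᵐ[ν] fun s => θ (t, s))
    {R : Lp ℝ 2 μ →L[ℝ] Lp ℝ q ν}
    (hR : ∀ g B, MeasurableSet B → ∫ s in B, R g s ∂ν = ∫ t, g t * ∫ s in B, Θ t s ∂ν ∂μ)
    {h : ℕ → Lp ℝ 2 μ} (hh : IsONBSeq h) :
    ∀ᵐ s ∂ν, ∫⁻ t, ‖θ (t, s)‖ₑ ^ 2 ∂μ ≤ ∑' n, ‖R (h n) s‖ₑ ^ 2 := by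
  have hθi : Integrable θ (μ.prod ν) :=
    integrable_representative (hΘ.integrable (by norm_num)) hθ hrep
  obtain ⟨𝒞, h𝒞c, h𝒞⟩ := MeasurableSpace.CountablyGenerated.isCountablyGenerated (α := A)
  let 𝒜 := generateSetAlgebra 𝒞
  have h𝒜c : 𝒜.Countable := countable_generateSetAlgebra h𝒞c
  have h𝒜 : IsSetAlgebra 𝒜 := isSetAlgebra_generateSetAlgebra
  have hgen : ‹MeasurableSpace A› = MeasurableSpace.generateFrom 𝒜 := by
    rw [generateFrom_generateSetAlgebra_eq, h𝒞]
  have hmeas : ∀ C ∈ 𝒜, MeasurableSet C := fun C hC => by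
    rw [hgen]; exact MeasurableSpace.measurableSet_generateFrom hC
  -- The operator applied to an indicator function is the integral over the set.
  have hindicator : ∀ C (hC : MeasurableSet C), ∀ᵐ s ∂ν,
      R (indicatorConstLp 2 hC (measure_ne_top μ C) 1) s = ∫ t in C, θ (t, s) ∂μ := by
    intro C hC
    have hθC : Integrable θ ((μ.restrict C).prod ν) := by
      have := hθi.restrict (s := C ×ˢ univ)
      rwa [← Measure.prod_restrict, Measure.restrict_univ] at this
    refine Integrable.ae_eq_of_forall_setIntegral_eq _ _
      ((Lp.memLp _).integrable Fact.out) hθC.integral_prod_right fun B hB _ => ?_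
    rw [hR _ _ hB]
    have e1 : ∫ t, (indicatorConstLp 2 hC (measure_ne_top μ C) (1 : ℝ)) t *
        ∫ s in B, Θ t s ∂ν ∂μ = ∫ t in C, ∫ s in B, θ (t, s) ∂ν ∂μ := by
      rw [← integral_indicator hC]
      refine integral_congr_ae ?_
      filter_upwards [indicatorConstLp_coeFn (p := 2) (hs := hC) (hμs := measure_ne_top μ C)
        (c := (1 : ℝ)), hrep] with t ht ht'
      rw [ht]
      by_cases htC : t ∈ C
      · simp only [indicator_of_mem htC, one_mul]
        exact integral_congr_ae (ae_restrict_of_ae ht')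
      · simp only [indicator_of_notMem htC, zero_mul]
    rw [e1]
    refine integral_integral_swap ?_
    have := hθi.restrict (s := C ×ˢ B)
    rwa [← Measure.prod_restrict] at this
  -- If `g` has the coefficients `R hₙ (s)`, expanding the indicator in the basis `h` gives the
  -- integral of `g`; convergence of the expansion in `L^q` identifies the pointwise limit.
  have hexpand : ∀ C (hC : MeasurableSet C), ∀ᵐ s ∂ν, ∀ g : Lp ℝ 2 μ,
      (∀ n, inner ℝ (h n) g = R (h n) s) →
        R (indicatorConstLp 2 hC (measure_ne_top μ C) 1) s = ∫ t in C, g t ∂μ := by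
    intro C hC
    set χ : Lp ℝ 2 μ := indicatorConstLp 2 hC (measure_ne_top μ C) 1 with hχ
    have h1 : Tendsto (fun N => ∑ n ∈ Finset.range N, (inner ℝ (h n) χ : ℝ) • R (h n)) atTop
        (𝓝 (R χ)) := by
      have := ((hh.hasSum_repr χ).mapL R).tendsto_sum_nat
      simpa using this
    have h2 : ∀ᵐ s ∂ν, ∀ N, (∑ n ∈ Finset.range N, (inner ℝ (h n) χ : ℝ) • R (h n) :
        Lp ℝ q ν) s = ∑ n ∈ Finset.range N, inner ℝ (h n) χ * R (h n) s :=
      ae_all_iff.2 fun N => coeFn_gaussSum (fun n => R (h n)) (Finset.range N)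
        (fun n => inner ℝ (h n) χ)
    filter_upwards [ae_eq_of_tendsto_Lp h1, h2] with s hs hs2 g hg
    refine hs _ ?_
    simp_rw [hs2]
    have h3 := (hh.hasSum_inner_mul_inner g χ).tendsto_sum_nat
    rw [real_inner_comm, hχ, L2.inner_indicatorConstLp_one hC] at h3
    refine h3.congr fun N => Finset.sum_congr rfl fun n _ => ?_
    rw [← hg n, real_inner_comm, mul_comm]
  have hcoincide : ∀ᵐ s ∂ν, ∀ C : 𝒜, ∀ g : Lp ℝ 2 μ, (∀ n, inner ℝ (h n) g = R (h n) s) →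
      ∫ t in C, θ (t, s) ∂μ = ∫ t in C, g t ∂μ := by
    have : Countable 𝒜 := h𝒜c.to_subtype
    refine ae_all_iff.2 fun C => ?_
    filter_upwards [hindicator C (hmeas C C.2), hexpand C (hmeas C C.2)] with s h1 h2 g hg
    rw [← h1, h2 g hg]
  have h0 : ∀ᵐ s ∂ν, ∀ n, h n = 0 → R (h n) s = 0 := by
    refine ae_all_iff.2 fun n => ?_
    by_cases hn : h n = 0
    · filter_upwards [Lp.coeFn_zero ℝ q ν] with s hs _
      rw [hn, map_zero, hs, Pi.zero_apply]
    · exact Eventually.of_forall fun s hn' => absurd hn' hn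
  filter_upwards [hcoincide, h0, hθi.prod_left_ae] with s hs hs0 hsi
  by_cases hfin : ∑' n, ‖R (h n) s‖ₑ ^ 2 = ∞
  · rw [hfin]; exact le_top
  obtain ⟨g, hg⟩ := hh.exists_inner_eq hfin hs0
  have hae : (fun t => θ (t, s)) =ᵐ[μ] g :=
    ae_eq_of_setIntegral_eq_of_isSetAlgebra h𝒜 hgen hsi ((Lp.memLp g).integrable (by norm_num))
      fun C hC => hs ⟨C, hC⟩ g hg
  refine le_of_eq ?_
  calc ∫⁻ t, ‖θ (t, s)‖ₑ ^ 2 ∂μ = ∫⁻ t, ‖g t‖ₑ ^ 2 ∂μ := by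
        refine lintegral_congr_ae ?_
        filter_upwards [hae] with t ht
        rw [ht]
    _ = ‖g‖ₑ ^ 2 := by
        rw [Lp.enorm_def, eLpNorm_eq_lintegral_rpow_enorm_toReal two_ne_zero
          ENNReal.ofNat_ne_top, ← ENNReal.rpow_two, ← ENNReal.rpow_mul]
        simp
    _ = _ := by
        rw [← hh.tsum_enorm_inner_sq g]
        refine tsum_congr fun n => ?_
        rw [← hg n, real_inner_comm]

end SquareIntegrable

/-! ### Composition with bounded operators -/

section Composition

variable {G : Type*} [NormedAddCommGroup G] [InnerProductSpace ℝ G]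
  {X Y : Type*} [NormedAddCommGroup X] [NormedSpace ℝ X] [NormedAddCommGroup Y] [NormedSpace ℝ Y]

lemma eLpNorm_clm_comp_le {A : Type*} [MeasurableSpace A] {μ : Measure A} (J : Y →L[ℝ] X)
    (f : A → Y) (p : ℝ≥0∞) : eLpNorm (fun t => J (f t)) p μ ≤ ‖J‖₊ * eLpNorm f p μ := by
  have := eLpNorm_le_nnreal_smul_eLpNorm_of_ae_le_mul (f := fun t => J (f t)) (g := f) (μ := μ)
    (c := ‖J‖₊) (Eventually.of_forall fun t => J.le_opNorm (f t)) p
  simpa [ENNReal.smul_def] using this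

lemma IsGaussianLimit.clm_comp (J : Y →L[ℝ] X) {R : G →L[ℝ] Y} {h : ℕ → G}
    {ζ : (ℕ → ℝ) → Y} (hζ : IsGaussianLimit R h ζ) :
    IsGaussianLimit (J.comp R) h (fun ω => J (ζ ω)) := by
  refine ⟨hζ.basis, J.comp_memLp' hζ.memLp, ?_⟩
  have h1 : ∀ N, gaussianSum (J.comp R) h N - (fun ω => J (ζ ω)) =
      fun ω => J ((gaussianSum R h N - ζ) ω) := by
    intro N
    ext1 ω
    simp [gaussianSum]
  simp_rw [h1]
  refine tendsto_of_tendsto_of_tendsto_of_le_of_le tendsto_const_nhds ?_ (fun _ => zero_le)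
    (fun N => eLpNorm_clm_comp_le J _ 2)
  have := ENNReal.Tendsto.const_mul (a := (‖J‖₊ : ℝ≥0∞)) hζ.tendsto (.inr ENNReal.coe_ne_top)
  rwa [mul_zero] at this

variable {A : Type*} [MeasurableSpace A] {μ : Measure A}
  {H : Type*} [NormedAddCommGroup H] [InnerProductSpace ℝ H] [CompleteSpace H]

lemma IsRepresentedBy.clm_comp (J : Y →L[ℝ] X) {R : Lp H 2 μ →L[ℝ] Y} {Φ : A → H →L[ℝ] Y}
    (hR : IsRepresentedBy μ R Φ) : IsRepresentedBy μ (J.comp R) fun t => J.comp (Φ t) :=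
  ⟨fun x' => hR.memLp (x'.comp J), fun f x' => hR.pairing f (x'.comp J)⟩

omit [MeasurableSpace A] in
lemma inner_adjointFun (Φ : A → H →L[ℝ] X) (x' : X →L[ℝ] ℝ) (t : A) (v : H) :
    inner ℝ v (adjointFun Φ x' t) = x' (Φ t v) := by
  rw [real_inner_comm, adjointFun, InnerProductSpace.toDual_symm_apply]
  rfl

/-- A weakly measurable function with values in a separable Hilbert space is strongly
measurable, here for `t ↦ Φ(t)* x'`: expand it in an orthonormal basis. -/
lemma aestronglyMeasurable_adjointFun [TopologicalSpace.SeparableSpace H] {Φ : A → H →L[ℝ] X}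
    (hΦ : ∀ v, AEStronglyMeasurable (fun t => Φ t v) μ) (x' : X →L[ℝ] ℝ) :
    AEStronglyMeasurable (adjointFun Φ x') μ := by
  obtain ⟨d, hd⟩ := exists_isONBSeq (G := H)
  refine aestronglyMeasurable_of_tendsto_ae atTop
    (f := fun N t => ∑ n ∈ Finset.range N, (inner ℝ (d n) (adjointFun Φ x' t) : ℝ) • d n)
    (fun N => ?_) (Eventually.of_forall fun t => (hd.hasSum_repr _).tendsto_sum_nat)
  simp_rw [inner_adjointFun]
  refine Finset.aestronglyMeasurable_fun_sum _ fun n _ => ?_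
  exact (x'.continuous.comp_aestronglyMeasurable (hΦ (d n))).smul_const (d n)

end Composition

/-! ### Multiplication operators composed with a kernel operator -/

section KernelOperator

variable {α : Type*} [MeasurableSpace α] {ν : Measure α}

/-- The data of an operator `i : H → L^∞` given by a bounded strongly measurable kernel
`k : α → H`, that is, `(i h)(s) = ⟨k s, h⟩`. -/
structure IsBoundedKernel {H : Type*} [NormedAddCommGroup H] [InnerProductSpace ℝ H]
    (i : H →L[ℝ] Lp ℝ ∞ ν) (k : α → H) (K : ℝ≥0) : Prop where
  stronglyMeasurable : StronglyMeasurable k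
  enorm_le : ∀ᵐ s ∂ν, ‖k s‖ₑ ≤ K
  apply_ae_eq : ∀ h, i h =ᵐ[ν] fun s => inner ℝ (k s) h

lemma summable_smul_of_orthonormal {ι H : Type*} [NormedAddCommGroup H] [InnerProductSpace ℝ H]
    [CompleteSpace H] {e : ι → H} (he : Orthonormal ℝ e) {v : ι → ℝ}
    (hv : Summable fun n => v n ^ 2) : Summable fun n => v n • e n := by
  have h1 := he.orthogonalFamily.summable_iff_norm_sq_summable v
  simp only [LinearIsometry.toSpanSingleton_apply, Real.norm_eq_abs, sq_abs] at h1
  exact h1.2 hv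

/-- If `∑ λₙ |eₙ|²` is bounded by `K²`, the kernel of `∑ √λₙ eₙ ⊗ eₙ` is
`k s = ∑ √λₙ eₙ(s) eₙ`, whose norm is `(∑ λₙ |eₙ(s)|²)^(1/2)`. -/
lemma exists_isBoundedKernel [IsFiniteMeasure ν] {lam : ℕ → ℝ} {e : ℕ → Lp ℝ 2 ν}
    (hlam : ∀ n, 0 ≤ lam n) (he : Orthonormal ℝ e) {M : ℝ} (hM : ∀ n, lam n ≤ M) {K : ℝ≥0}
    (hK : ∀ᵐ s ∂ν, ∑' n, ENNReal.ofReal (lam n * |e n s| ^ 2) ≤ (K : ℝ≥0∞) ^ 2) :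
    ∃ (i : Lp ℝ 2 ν →L[ℝ] Lp ℝ ∞ ν) (k : α → Lp ℝ 2 ν), IsBoundedKernel i k K ∧
      ∀ h, ∃ g : Lp ℝ 2 ν, HasSum (fun n => (√(lam n) * inner ℝ (e n) h) • e n) g ∧
        i h =ᵐ[ν] g := by
  let k : α → Lp ℝ 2 ν := fun s =>
    limUnder atTop fun N => ∑ n ∈ Finset.range N, (√(lam n) * e n s) • e n
  have hkm : StronglyMeasurable k := by
    refine StronglyMeasurable.limUnder fun N => ?_
    refine Finset.stronglyMeasurable_fun_sum _ fun n _ => ?_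
    exact ((Lp.stronglyMeasurable (e n)).const_mul _).smul_const (e n)
  have hsq : ∀ n s, (√(lam n) * e n s) ^ 2 = lam n * |e n s| ^ 2 := by
    intro n s
    rw [mul_pow, Real.sq_sqrt (hlam n), sq_abs]
  have hsum : ∀ᵐ s ∂ν, Summable fun n => lam n * |e n s| ^ 2 := by
    filter_upwards [hK] with s hs
    have h1 := ENNReal.summable_toReal
      (hs.trans_lt (ENNReal.pow_lt_top ENNReal.coe_lt_top)).ne
    refine h1.congr fun n => ?_
    rw [ENNReal.toReal_ofReal (mul_nonneg (hlam n) (sq_nonneg _))]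
  have hk : ∀ᵐ s ∂ν, HasSum (fun n => (√(lam n) * e n s) • e n) (k s) := by
    filter_upwards [hsum] with s hs
    have h1 : Summable fun n => (√(lam n) * e n s) • e n :=
      summable_smul_of_orthonormal he (by simpa only [hsq] using hs)
    have h2 : k s = ∑' n, (√(lam n) * e n s) • e n := h1.hasSum.tendsto_sum_nat.limUnder_eq
    rw [h2]
    exact h1.hasSum
  have hkK : ∀ᵐ s ∂ν, ‖k s‖ ≤ K := by
    filter_upwards [hk, hK, hsum] with s hs hs' hs''
    have h1 : Tendsto (fun N => ‖∑ n ∈ Finset.range N, (√(lam n) * e n s) • e n‖) atTop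
        (𝓝 ‖k s‖) := hs.tendsto_sum_nat.norm
    refine le_of_tendsto' h1 fun N => ?_
    refine abs_le_of_sq_le_sq' ?_ K.2 |>.2
    have h2 : ‖∑ n ∈ Finset.range N, (√(lam n) * e n s) • e n‖ ^ 2 =
        ∑ n ∈ Finset.range N, lam n * |e n s| ^ 2 := by
      rw [← real_inner_self_eq_norm_sq, he.inner_sum]
      refine Finset.sum_congr rfl fun n _ => ?_
      rw [← hsq, sq]
      rfl
    rw [h2]
    have h3 := hs''.sum_le_tsum (Finset.range N)
      (fun n _ => mul_nonneg (hlam n) (sq_nonneg (|e n s|)))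
    refine h3.trans ?_
    rw [← ENNReal.ofReal_tsum_of_nonneg (fun n => mul_nonneg (hlam n) (sq_nonneg _)) hs''] at hs'
    have h4 := ENNReal.toReal_mono (ENNReal.pow_ne_top ENNReal.coe_ne_top) hs'
    rw [ENNReal.toReal_ofReal
      (tsum_nonneg fun n => mul_nonneg (hlam n) (sq_nonneg _))] at h4
    simpa using h4
  have hbd : ∀ h : Lp ℝ 2 ν, ∀ᵐ s ∂ν, ‖(inner ℝ (k s) h : ℝ)‖ ≤ K * ‖h‖ := by
    intro h
    filter_upwards [hkK] with s hs
    refine (norm_inner_le_norm _ _).trans ?_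
    gcongr
  have hmem : ∀ h : Lp ℝ 2 ν, MemLp (fun s => (inner ℝ (k s) h : ℝ)) ∞ ν := fun h =>
    memLp_top_of_bound (hkm.inner stronglyMeasurable_const).aestronglyMeasurable _ (hbd h)
  let i : Lp ℝ 2 ν →L[ℝ] Lp ℝ ∞ ν := LinearMap.mkContinuous
    { toFun := fun h => (hmem h).toLp _
      map_add' := fun h h' => by
        rw [← MemLp.toLp_add]
        exact MemLp.toLp_congr _ _ (Eventually.of_forall fun s => inner_add_right _ _ _)
      map_smul' := fun c h => by
        rw [RingHom.id_apply, ← MemLp.toLp_const_smul]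
        exact MemLp.toLp_congr _ _ (Eventually.of_forall fun s => real_inner_smul_right _ _ _) }
    K (fun h => by
      have h1 : ∀ᵐ s ∂ν, ‖((hmem h).toLp _ : Lp ℝ ∞ ν) s‖ ≤ K * ‖h‖ := by
        filter_upwards [hbd h, (hmem h).coeFn_toLp] with s hs hs'
        rwa [hs']
      have h2 := Lp.norm_le_of_ae_bound (by positivity) h1
      simpa using h2)
  have hi : ∀ h, i h =ᵐ[ν] fun s => inner ℝ (k s) h := fun h => (hmem h).coeFn_toLp
  refine ⟨i, k, ⟨hkm, ?_, hi⟩, fun h => ?_⟩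
  · filter_upwards [hkK] with s hs
    rw [enorm_le_coe]
    exact hs
  · have hs1 : Summable fun n => (√(lam n) * inner ℝ (e n) h) ^ 2 := by
      have h1 := (he.inner_products_summable h).mul_left M
      refine h1.of_nonneg_of_le (fun n => sq_nonneg _) fun n => ?_
      rw [mul_pow, Real.sq_sqrt (hlam n), Real.norm_eq_abs, sq_abs]
      exact mul_le_mul_of_nonneg_right (hM n) (sq_nonneg _)
    have hs2 := summable_smul_of_orthonormal he hs1
    refine ⟨_, hs2.hasSum, ?_⟩
    have h2 : ∀ᵐ s ∂ν, ∀ N, (∑ n ∈ Finset.range N, (√(lam n) * inner ℝ (e n) h) • e n :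
        Lp ℝ 2 ν) s = ∑ n ∈ Finset.range N, (√(lam n) * inner ℝ (e n) h) * e n s :=
      ae_all_iff.2 fun N => coeFn_gaussSum e (Finset.range N) fun n => √(lam n) * inner ℝ (e n) h
    filter_upwards [hi h, ae_eq_of_tendsto_Lp hs2.hasSum.tendsto_sum_nat, h2, hk] with s a b c d
    rw [a]
    refine (b _ ?_).symm
    simp_rw [c]
    have h3 := (d.mapL (innerSL ℝ h)).tendsto_sum_nat
    simp only [innerSL_apply_apply, real_inner_smul_right] at h3
    rw [real_inner_comm] at h3
    refine h3.congr fun N => Finset.sum_congr rfl fun n _ => ?_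
    rw [real_inner_comm h]
    ring

lemma eLpNorm_const_mul_of_measurable {q : ℝ≥0∞} (hq0 : q ≠ 0) (hq : q ≠ ∞) (c : ℝ≥0∞)
    {σ : α → ℝ≥0∞} (hσ : Measurable σ) :
    eLpNorm (fun s => c * σ s) q ν = c * eLpNorm σ q ν := by
  have hr0 : 0 < q.toReal := ENNReal.toReal_pos hq0 hq
  simp_rw [eLpNorm_eq_lintegral_rpow_enorm_toReal hq0 hq, enorm_eq_self,
    ENNReal.mul_rpow_of_nonneg _ _ hr0.le]
  rw [lintegral_const_mul _ (hσ.pow_const _), ENNReal.mul_rpow_of_nonneg _ _ (by positivity),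
    ← ENNReal.rpow_mul, mul_one_div_cancel hr0.ne', ENNReal.rpow_one]

variable {H : Type*} [NormedAddCommGroup H] [InnerProductSpace ℝ H]
  {q : ℝ≥0∞} [Fact (1 ≤ q)]

/-- The bilinear map `(y, h) ↦ y · (i h)` for an operator `i` with values in `L^∞`. -/
def mulBilin (i : H →L[ℝ] Lp ℝ ∞ ν) : Lp ℝ q ν →L[ℝ] H →L[ℝ] Lp ℝ q ν :=
  (((ContinuousLinearMap.mul ℝ ℝ).holderL ν q ∞ q).flip.comp i).flip

lemma coeFn_mulBilin {i : H →L[ℝ] Lp ℝ ∞ ν} {k : α → H} {K : ℝ≥0} (hk : IsBoundedKernel i k K)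
    (y : Lp ℝ q ν) (h : H) : mulBilin i y h =ᵐ[ν] fun s => y s * inner ℝ (k s) h := by
  have h1 : mulBilin i y h =ᵐ[ν] fun s => y s * i h s :=
    (ContinuousLinearMap.mul ℝ ℝ).coeFn_holder y (i h)
  filter_upwards [h1, hk.apply_ae_eq h] with s a b
  rw [a, b]

variable {A : Type*} [MeasurableSpace A] {μ : Measure A}
  [CompleteSpace H] [TopologicalSpace.SeparableSpace H]

/-- The operator `g ↦ ∫ Θ(t) · (i g(t)) dμ(t)` is represented by `t ↦ Θ(t) · i`. -/
lemma exists_isRepresentedBy_mulBilin (i : H →L[ℝ] Lp ℝ ∞ ν) {Θ : A → Lp ℝ q ν}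
    (hΘ : MemLp Θ 2 μ) : ∃ R : Lp H 2 μ →L[ℝ] Lp ℝ q ν,
      (∀ g : Lp H 2 μ, Integrable (fun t => mulBilin i (Θ t) (g t)) μ ∧
        R g = ∫ t, mulBilin i (Θ t) (g t) ∂μ) ∧
      IsRepresentedBy μ R fun t => mulBilin i (Θ t) := by
  let B : Lp ℝ q ν →L[ℝ] H →L[ℝ] Lp ℝ q ν := mulBilin i
  let R : Lp H 2 μ →L[ℝ] Lp ℝ q ν :=
    (L1.integralCLM' ℝ).comp (B.holderL μ 2 2 1 (hΘ.toLp Θ))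
  have hae : ∀ g : Lp H 2 μ, (B.holderL μ 2 2 1 (hΘ.toLp Θ) g : A → Lp ℝ q ν) =ᵐ[μ]
      fun t => B (Θ t) (g t) := by
    intro g
    have h1 : (B.holderL μ 2 2 1 (hΘ.toLp Θ) g : A → Lp ℝ q ν) =ᵐ[μ]
      fun t => B (hΘ.toLp Θ t) (g t) := B.coeFn_holder (hΘ.toLp Θ) g
    filter_upwards [h1, hΘ.coeFn_toLp] with t a b
    rw [a, b]
  have hint : ∀ g : Lp H 2 μ, Integrable (fun t => B (Θ t) (g t)) μ := fun g =>
    (L1.integrable_coeFn _).congr (hae g)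
  have hR : ∀ g : Lp H 2 μ, R g = ∫ t, B (Θ t) (g t) ∂μ := by
    intro g
    rw [← integral_congr_ae (hae g), ← L1.integral_eq_integral]
    rw [L1.integral_eq]
    rfl
  refine ⟨R, fun g => ⟨hint g, hR g⟩, fun x' => ?_, fun g x' => ?_⟩
  · have hm : AEStronglyMeasurable (adjointFun (fun t => B (Θ t)) x') μ :=
      aestronglyMeasurable_adjointFun (fun v =>
        (B.flip v).continuous.comp_aestronglyMeasurable hΘ.aestronglyMeasurable) x'
    refine hΘ.of_le_mul (c := ‖x'‖ * ‖B‖) hm (Eventually.of_forall fun t => ?_)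
    rw [adjointFun, LinearIsometryEquiv.norm_map]
    refine (ContinuousLinearMap.opNorm_comp_le _ _).trans ?_
    rw [mul_assoc]
    gcongr
    exact B.le_opNorm _
  · rw [hR, ← ContinuousLinearMap.integral_comp_comm _ (hint g)]
    simp_rw [inner_adjointFun]
    rfl

/-- A multiplication operator with a kernel operator belongs to `γ(μ; H, L^q)` if the square
function of the multiplier is in `L^q`. -/
lemma exists_isRepresentedBy_isGaussianLimit [IsFiniteMeasure ν]
    [MeasurableSpace.CountablyGenerated A] (hq : q ≠ ∞) : ∃ C : ℝ≥0,
      ∀ (i : H →L[ℝ] Lp ℝ ∞ ν) (k : α → H) (K : ℝ≥0), IsBoundedKernel i k K →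
      ∀ (μ : Measure A) [IsFiniteMeasure μ] (Θ : A → Lp ℝ q ν), MemLp Θ 2 μ →
      ∀ (θ : A × α → ℝ), Measurable θ →
        (∀ᵐ t ∂μ, (Θ t : α → ℝ) =ᵐ[ν] fun s => θ (t, s)) →
        eLpNorm (fun s => (∫⁻ t, ‖θ (t, s)‖ₑ ^ 2 ∂μ) ^ (1 / 2 : ℝ)) q ν ≠ ∞ →
        ∃ (R : Lp H 2 μ →L[ℝ] Lp ℝ q ν) (h : ℕ → Lp H 2 μ) (ζ : (ℕ → ℝ) → Lp ℝ q ν),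
          IsRepresentedBy μ R (fun t => mulBilin i (Θ t)) ∧ IsGaussianLimit R h ζ ∧
          eLpNorm ζ 2 gaussianSequence ≤ C * (K *
            eLpNorm (fun s => (∫⁻ t, ‖θ (t, s)‖ₑ ^ 2 ∂μ) ^ (1 / 2 : ℝ)) q ν) := by
  have hq0 : q ≠ 0 := (zero_lt_one.trans_le Fact.out).ne'
  have hr0 : 0 < q.toReal := ENNReal.toReal_pos hq0 hq
  obtain ⟨C, hC⟩ := exists_isGaussianLimit_le (ν := ν) hq
  refine ⟨C, fun i k K hk μ _ Θ hΘ θ hθ hrep hfin => ?_⟩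
  obtain ⟨R, hR, hRrep⟩ := exists_isRepresentedBy_mulBilin (μ := μ) i hΘ
  have : Fact ((2 : ℝ≥0∞) ≠ ∞) := ⟨ENNReal.ofNat_ne_top⟩
  obtain ⟨h, hh⟩ := exists_isONBSeq (G := Lp H 2 μ)
  set σ : α → ℝ≥0∞ := fun s => (∫⁻ t, ‖θ (t, s)‖ₑ ^ 2 ∂μ) ^ (1 / 2 : ℝ) with hσ
  have hσm : Measurable σ :=
    (Measurable.lintegral_prod_left' (f := fun p : A × α => ‖θ p‖ₑ ^ 2)
      (hθ.enorm.pow_const 2)).pow_const _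
  have hσt : ∀ᵐ s ∂ν, σ s < ∞ := by
    have h1 := (eLpNorm_lt_top_iff_lintegral_rpow_enorm_lt_top hq0 hq).1 hfin.lt_top
    simp_rw [enorm_eq_self] at h1
    filter_upwards [ae_lt_top (hσm.pow_const _) h1.ne] with s hs
    exact (ENNReal.rpow_lt_top_iff_of_pos hr0).1 hs
  -- The section `θ(·, s)` times the vector `k s`, as an element of `L²(μ; H)`.
  have hnorm : ∀ s, eLpNorm (fun t => θ (t, s) • k s) 2 μ ≤ ‖k s‖ₑ * σ s := by
    intro s
    have h1 : eLpNorm (fun t => θ (t, s)) 2 μ = σ s := by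
      rw [eLpNorm_eq_lintegral_rpow_enorm_toReal two_ne_zero ENNReal.ofNat_ne_top]
      simp [hσ]
    rw [← h1]
    have h2 := eLpNorm_le_nnreal_smul_eLpNorm_of_ae_le_mul (f := fun t => θ (t, s) • k s)
      (g := fun t => θ (t, s)) (μ := μ) (c := ‖k s‖₊) (Eventually.of_forall fun t => by
        rw [nnnorm_smul, mul_comm]) 2
    rwa [ENNReal.smul_def, smul_eq_mul] at h2
  have hmem : ∀ s, σ s < ∞ → MemLp (fun t => θ (t, s) • k s) 2 μ := fun s hs =>
    ⟨((hθ.comp measurable_prodMk_right).aestronglyMeasurable.smul_const _),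
      (hnorm s).trans_lt (ENNReal.mul_lt_top enorm_lt_top hs)⟩
  classical
  let Ψ : α → Lp H 2 μ := fun s => if hs : σ s < ∞ then (hmem s hs).toLp _ else 0
  have hRΨ : ∀ g, R g =ᵐ[ν] fun s => inner ℝ (Ψ s) g := by
    intro g
    have hξ : Measurable fun p : A × α => θ p * inner ℝ (k p.2) (g p.1) :=
      hθ.mul ((hk.stronglyMeasurable.comp_measurable measurable_snd).inner
        ((Lp.stronglyMeasurable g).comp_measurable measurable_fst)).measurable
    have h1 := coeFn_integral (hR g).1 hξ (by
      filter_upwards [hrep] with t ht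
      filter_upwards [ht, coeFn_mulBilin hk (Θ t) (g t)] with s a b
      rw [b, a])
    rw [← (hR g).2] at h1
    filter_upwards [h1, hσt] with s hs hs'
    rw [hs, L2.inner_def]
    refine integral_congr_ae ?_
    simp only [Ψ, dif_pos hs']
    filter_upwards [(hmem s hs').coeFn_toLp] with t ht
    rw [ht, real_inner_smul_left]
  have hΨ : ∀ᵐ s ∂ν, ‖Ψ s‖ₑ ≤ K * σ s := by
    filter_upwards [hσt, hk.enorm_le] with s hs hs'
    simp only [Ψ, dif_pos hs]
    rw [Lp.enorm_def, eLpNorm_congr_ae (hmem s hs).coeFn_toLp]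
    refine (hnorm s).trans ?_
    gcongr
  have hKσ : eLpNorm (fun s => K * σ s) q ν = K * eLpNorm σ q ν :=
    eLpNorm_const_mul_of_measurable hq0 hq _ hσm
  obtain ⟨ζ, hζ, hζ'⟩ := hC _ R h Ψ (fun s => K * σ s) hh hRΨ hΨ
    (by rw [hKσ]; exact ENNReal.mul_ne_top ENNReal.coe_ne_top hfin)
  exact ⟨R, h, ζ, hRrep, hζ, by rwa [hKσ] at hζ'⟩

end KernelOperator

/-! ### The square function is controlled by the `γ`-norm -/

section SquareFunctionBound

variable {A α : Type*} [MeasurableSpace A] [MeasurableSpace.CountablyGenerated A]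
  [MeasurableSpace α] {ν : Measure α} [IsFiniteMeasure ν] {q : ℝ≥0∞} [Fact (1 ≤ q)]

/-- Applied to every operator and every Gaussian limit over which the infimum in `gaussNorm` is
taken, so that independence of the orthonormal basis is not needed. -/
lemma exists_squareFun_le_gaussNorm {X : Type*} [NormedAddCommGroup X] [NormedSpace ℝ X]
    (hq : q ≠ ∞) : ∃ C : ℝ≥0,
      ∀ (μ : Measure A) [IsFiniteMeasure μ] (P : X →L[ℝ] Lp ℝ q ν), ‖P‖ ≤ 1 →
      ∀ ψ : A → X, MemLp ψ 2 μ → ∀ θ : A × α → ℝ, Measurable θ →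
        (∀ᵐ t ∂μ, (P (ψ t) : α → ℝ) =ᵐ[ν] fun s => θ (t, s)) →
        eLpNorm (fun s => (∫⁻ t, ‖θ (t, s)‖ₑ ^ 2 ∂μ) ^ (1 / 2 : ℝ)) q ν ≤
          C * gaussNorm μ (scalarFun ψ) := by
  obtain ⟨C, hC0, hC⟩ := exists_squareFun_le_of_isGaussianLimit (ν := ν) hq
  refine ⟨C, fun μ _ P hP ψ hψ θ hθ hrep => ?_⟩
  have hC0' : (C : ℝ≥0∞) ≠ 0 := by exact_mod_cast hC0
  simp_rw [gaussNorm, gammaNorm, ENNReal.mul_iInf_of_ne hC0' ENNReal.coe_ne_top]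
  refine le_iInf fun R => le_iInf fun hR => le_iInf fun h => le_iInf fun ζ => le_iInf fun hζ => ?_
  have hζ' := hζ.clm_comp P
  have hRB : ∀ (g : Lp ℝ 2 μ) (B : Set α), MeasurableSet B →
      ∫ s in B, (P.comp R) g s ∂ν = ∫ t, g t * ∫ s in B, P (ψ t) s ∂ν ∂μ := by
    intro g B _
    have h1 := hR.pairing g ((setIntegralCLM ν q B).comp P)
    simp_rw [inner_adjointFun] at h1
    refine h1.trans (integral_congr_ae (Eventually.of_forall fun t => ?_))
    simp [scalarFun, setIntegralCLM_apply]
  have h1 := ae_lintegral_sq_le_tsum (P.comp_memLp' hψ) hθ hrep hRB hζ.basis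
  calc eLpNorm (fun s => (∫⁻ t, ‖θ (t, s)‖ₑ ^ 2 ∂μ) ^ (1 / 2 : ℝ)) q ν
      ≤ eLpNorm (fun s => (∑' n, ‖(P.comp R) (h n) s‖ₑ ^ 2) ^ (1 / 2 : ℝ)) q ν := by
        refine eLpNorm_mono_enorm_ae ?_
        filter_upwards [h1] with s hs
        simp only [enorm_eq_self]
        exact ENNReal.rpow_le_rpow hs (by norm_num)
    _ ≤ C * eLpNorm (fun ω => P (ζ ω)) 2 gaussianSequence := hC _ _ h _ hζ'
    _ ≤ C * eLpNorm ζ 2 gaussianSequence := by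
        gcongr
        refine (eLpNorm_clm_comp_le P ζ 2).trans ?_
        refine (mul_le_mul_left (b := (‖P‖₊ : ℝ≥0∞)) (c := 1) ?_ _).trans_eq (one_mul _)
        exact_mod_cast hP

end SquareFunctionBound

/-! ### Estimates for the superposition operator -/

section Superposition

lemma norm_le_of_ae_abs_le {α : Type*} [MeasurableSpace α] {ν : Measure α} [IsFiniteMeasure ν]
    {q : ℝ≥0∞} [Fact (1 ≤ q)] {F u v : Lp ℝ q ν} {c₀ c₁ : ℝ} (h₁ : 0 ≤ c₁)
    (h : ∀ᵐ s ∂ν, |F s| ≤ c₀ + c₁ * (|u s| + |v s|)) :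
    ‖F‖ ≤ ‖Lp.const q ν c₀‖ + c₁ * (‖u‖ + ‖v‖) := by
  have h2 : ‖F‖ ≤ ‖Lp.const q ν c₀ + c₁ • (|u| + |v|)‖ := by
    refine Lp.norm_le_norm_of_ae_le ?_
    filter_upwards [h, Lp.coeFn_add (Lp.const q ν c₀) (c₁ • (|u| + |v|)), Lp.coeFn_const q ν c₀,
      Lp.coeFn_smul c₁ (|u| + |v|), Lp.coeFn_add |u| |v|, Lp.coeFn_abs u, Lp.coeFn_abs v]
      with s h a b c d e f
    rw [a, Pi.add_apply, b, c, Pi.smul_apply, d, Pi.add_apply, e, f, Real.norm_eq_abs]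
    exact h.trans (le_abs_self _)
  refine h2.trans ((norm_add_le _ _).trans ?_)
  gcongr
  rw [norm_smul, Real.norm_of_nonneg h₁]
  gcongr
  refine (norm_add_le _ _).trans ?_
  rw [norm_abs_eq_norm, norm_abs_eq_norm]

variable {d : ℕ} {S : SmoothDomain d} {q : ℝ≥0∞} [Fact (1 ≤ q)]

variable (S q) in
/-- The projection `(x, ẋ) ↦ x` as a bounded operator to `L^q(S)`. -/
def positionCLM : StateSpace S q →L[ℝ] LSpace S q :=
  ((ContinuousLinearMap.fst ℝ (LSpace S q) (LSpace S q)).comp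
    (laplacianGraph S q).subtypeL).comp (ContinuousLinearMap.fst ℝ (EHalf S q) (LSpace S q))

variable (S q) in
/-- The projection `(x, ẋ) ↦ ẋ` as a bounded operator to `L^q(S)`. -/
def velocityCLM : StateSpace S q →L[ℝ] LSpace S q :=
  ContinuousLinearMap.snd ℝ (EHalf S q) (LSpace S q)

lemma norm_positionCLM_le : ‖positionCLM S q‖ ≤ 1 := by
  refine ContinuousLinearMap.opNorm_le_bound _ zero_le_one fun x => ?_
  rw [one_mul]
  exact (norm_fst_le (x.1 : LSpace S q × LSpace S q)).trans (norm_fst_le x)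

lemma norm_velocityCLM_le : ‖velocityCLM S q‖ ≤ 1 :=
  ContinuousLinearMap.norm_snd_le ..

lemma norm_position_le (x : StateSpace S q) : ‖position x‖ ≤ ‖x‖ :=
  (norm_fst_le (x.1 : LSpace S q × LSpace S q)).trans (norm_fst_le x)

lemma norm_velocity_le (x : StateSpace S q) : ‖velocity x‖ ≤ ‖x‖ := norm_snd_le x

variable {T : ℝ} {Ω : Type*} {mΩ : MeasurableSpace Ω}
  {𝓕 : Filtration (Icc (0 : ℝ) T) mΩ} {b : Icc (0 : ℝ) T → Ω → S.carrier → ℝ → ℝ → ℝ}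

lemma coeFn_superposition (hb : IsCoefficient S 𝓕 b) (t : Icc (0 : ℝ) T) (ω : Ω)
    (x : StateSpace S q) : superposition hb t ω x =ᵐ[S.vol]
      fun s => b t ω s (position x s) (velocity x s) :=
  (hb.memLp t ω (position x) (velocity x)).coeFn_toLp

lemma exists_abs_superposition_le (hb : IsCoefficient S 𝓕 b) : ∃ C : ℝ≥0, ∀ t ω
    (x : StateSpace S q), ∀ᵐ s ∂S.vol, |superposition hb t ω x s| ≤
      C + C * (|position x s| + |velocity x s|) := by
  obtain ⟨C, hC⟩ := hb.linearGrowth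
  refine ⟨C.toNNReal, fun t ω x => ?_⟩
  filter_upwards [coeFn_superposition hb t ω x] with s hs
  rw [hs]
  refine (hC t ω s _ _).trans ?_
  have : C ≤ C.toNNReal := Real.le_coe_toNNReal C
  nlinarith [abs_nonneg (position x s), abs_nonneg (velocity x s)]

lemma exists_abs_superposition_sub_le (hb : IsCoefficient S 𝓕 b) : ∃ L : ℝ≥0, L ≠ 0 ∧ ∀ t ω
    (x y : StateSpace S q), ∀ᵐ s ∂S.vol, |(superposition hb t ω x - superposition hb t ω y) s| ≤
      L * (|position (x - y) s| + |velocity (x - y) s|) := by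
  obtain ⟨L, hL⟩ := hb.lipschitz
  refine ⟨L.toNNReal + 1, by positivity, fun t ω x y => ?_⟩
  filter_upwards [coeFn_superposition hb t ω x, coeFn_superposition hb t ω y,
    Lp.coeFn_sub (superposition hb t ω x) (superposition hb t ω y),
    Lp.coeFn_sub (position x) (position y), Lp.coeFn_sub (velocity x) (velocity y)]
    with s h1 h2 h3 h4 h5
  have h4' : position (x - y) s = position x s - position y s := h4
  have h5' : velocity (x - y) s = velocity x s - velocity y s := h5
  rw [h3, Pi.sub_apply, h1, h2, h4', h5']
  refine (hL t ω s _ _ _ _).trans ?_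
  have : L ≤ (L.toNNReal + 1 : ℝ≥0) := by
    push_cast
    linarith [Real.le_coe_toNNReal L]
  gcongr

lemma continuous_superposition (hb : IsCoefficient S 𝓕 b) (t : Icc (0 : ℝ) T) (ω : Ω) :
    Continuous fun x : StateSpace S q => superposition hb t ω x := by
  obtain ⟨L, -, hL⟩ := exists_abs_superposition_sub_le (q := q) hb
  refine (LipschitzWith.of_dist_le_mul (K := 2 * L) fun x y => ?_).continuous
  rw [dist_eq_norm, dist_eq_norm]
  have h1 := norm_le_of_ae_abs_le (c₀ := 0) L.2
    (by filter_upwards [hL t ω x y] with s hs; rw [zero_add]; exact hs)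
  rw [map_zero, norm_zero, zero_add] at h1
  refine h1.trans ?_
  push_cast
  have h2 := norm_position_le (x - y)
  have h3 := norm_velocity_le (x - y)
  have h4 : (0 : ℝ) ≤ L := L.2
  calc (L : ℝ) * (‖position (x - y)‖ + ‖velocity (x - y)‖) ≤ L * (‖x - y‖ + ‖x - y‖) := by gcongr
    _ = _ := by ring

lemma stronglyMeasurable_superposition (hq : q ≠ ∞) (hb : IsCoefficient S 𝓕 b)
    (x : StateSpace S q) :
    StronglyMeasurable fun p : Icc (0 : ℝ) T × Ω => superposition hb p.1 p.2 x := by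
  have hu : Measurable (position x) := (Lp.stronglyMeasurable _).measurable
  have hv : Measurable (velocity x) := (Lp.stronglyMeasurable _).measurable
  have hm : Measurable fun p : (Icc (0 : ℝ) T × Ω) × S.carrier =>
      (p.1.1, p.1.2, p.2, position x p.2, velocity x p.2) := by fun_prop
  exact stronglyMeasurable_toLp hq
    (F := fun (p : Icc (0 : ℝ) T × Ω) s => b p.1 p.2 s (position x s) (velocity x s))
    (hb.measurable.comp hm) fun p => hb.memLp p.1 p.2 (position x) (velocity x)

lemma stronglyMeasurable_superposition_adapted (hq : q ≠ ∞) (hb : IsCoefficient S 𝓕 b)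
    (t : Icc (0 : ℝ) T) (x : StateSpace S q) :
    StronglyMeasurable[𝓕 t] fun ω => superposition hb t ω x := by
  have hu : Measurable (position x) := (Lp.stronglyMeasurable _).measurable
  have hv : Measurable (velocity x) := (Lp.stronglyMeasurable _).measurable
  have hm : Measurable[(𝓕 t).prod inferInstance, (𝓕 t).prod inferInstance]
      fun p : Ω × S.carrier => (p.1, p.2, position x p.2, velocity x p.2) := by
    let := 𝓕 t
    fun_prop
  exact stronglyMeasurable_toLp (mA := 𝓕 t) hq
    (F := fun ω s => b t ω s (position x s) (velocity x s))
    ((hb.adapted t).comp hm) fun ω => hb.memLp t ω (position x) (velocity x)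

lemma exists_norm_superposition_le (hb : IsCoefficient S 𝓕 b) : ∃ c₀ c₁ : ℝ, ∀ t ω
    (x : StateSpace S q), ‖superposition hb t ω x‖ ≤ c₀ + c₁ * ‖x‖ := by
  obtain ⟨C, hC⟩ := exists_abs_superposition_le (q := q) hb
  refine ⟨‖Lp.const q S.vol (C : ℝ)‖, 2 * C, fun t ω x => ?_⟩
  refine (norm_le_of_ae_abs_le C.2 (hC t ω x)).trans ?_
  have h2 := norm_position_le x
  have h3 := norm_velocity_le x
  have h4 : (0 : ℝ) ≤ C := C.2
  have : (C : ℝ) * (‖position x‖ + ‖velocity x‖) ≤ C * (‖x‖ + ‖x‖) := by gcongr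
  exact add_le_add le_rfl (this.trans_eq (by ring))

lemma secondCountableTopology_stateSpace (hq : q ≠ ∞) :
    SecondCountableTopology (StateSpace S q) := by
  have : Fact (q ≠ ∞) := ⟨hq⟩
  have i1 : SecondCountableTopology (LSpace S q) := inferInstance
  have i2 : SecondCountableTopology (EHalf S q) :=
    TopologicalSpace.Subtype.secondCountableTopology _
  exact inferInstanceAs (SecondCountableTopology (EHalf S q × LSpace S q))

lemma aestronglyMeasurable_superposition (hq : q ≠ ∞) (hb : IsCoefficient S 𝓕 b)
    {μ : Measure (Icc (0 : ℝ) T)} (ω : Ω)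
    {φ : Icc (0 : ℝ) T → StateSpace S q} (hφ : AEStronglyMeasurable φ μ) :
    AEStronglyMeasurable (fun t => superposition hb t ω (φ t)) μ := by
  have := secondCountableTopology_stateSpace (S := S) hq
  borelize (StateSpace S q)
  have h1 : StronglyMeasurable (Function.uncurry fun (x : StateSpace S q) t =>
      superposition hb t ω x) :=
    stronglyMeasurable_uncurry_of_continuous_of_stronglyMeasurable
      (fun t => continuous_superposition hb t ω)
      fun x => (stronglyMeasurable_superposition hq hb x).comp_measurable
        (measurable_id.prodMk measurable_const)
  have h2 : Measurable fun t => (hφ.mk φ t, t) :=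
    hφ.stronglyMeasurable_mk.measurable.prodMk measurable_id
  refine ⟨fun t => superposition hb t ω (hφ.mk φ t), h1.comp_measurable h2, ?_⟩
  filter_upwards [hφ.ae_eq_mk] with t ht
  rw [← ht]

lemma memLp_superposition (hq : q ≠ ∞) (hb : IsCoefficient S 𝓕 b)
    {μ : Measure (Icc (0 : ℝ) T)} [IsFiniteMeasure μ] (ω : Ω)
    {φ : Icc (0 : ℝ) T → StateSpace S q} (hφ : MemLp φ 2 μ) :
    MemLp (fun t => superposition hb t ω (φ t)) 2 μ := by
  obtain ⟨c₀, c₁, hc⟩ := exists_norm_superposition_le (q := q) hb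
  have hdom : MemLp (fun t => c₀ + c₁ * ‖φ t‖) 2 μ :=
    (memLp_const c₀).add (hφ.norm.const_mul c₁)
  exact hdom.mono' (aestronglyMeasurable_superposition hq hb ω hφ.aestronglyMeasurable)
    (Eventually.of_forall fun t => hc t ω (φ t))

end Superposition

/-! ### The central estimate -/

lemma eLpNorm_two_eq_lintegral_sq {A : Type*} [MeasurableSpace A] {μ : Measure A} (f : A → ℝ) :
    eLpNorm f 2 μ = (∫⁻ t, ‖f t‖ₑ ^ 2 ∂μ) ^ (1 / 2 : ℝ) := by
  rw [eLpNorm_eq_lintegral_rpow_enorm_toReal two_ne_zero ENNReal.ofNat_ne_top]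
  simp

section NoiseEstimate

variable {A α : Type*} [MeasurableSpace A] [MeasurableSpace.CountablyGenerated A]
  [MeasurableSpace α] {ν : Measure α} [IsFiniteMeasure ν] [IsSeparable ν] {q : ℝ≥0∞} [Fact (1 ≤ q)]
  {X Z H : Type*} [NormedAddCommGroup X] [NormedSpace ℝ X] [NormedAddCommGroup Z]
  [NormedSpace ℝ Z] [NormedAddCommGroup H] [InnerProductSpace ℝ H] [CompleteSpace H]
  [TopologicalSpace.SeparableSpace H]

/-- If a multiplier `Θ` is dominated pointwise by an affine function of two components of
`ψ ∈ γ(μ; X)`, then so is its square function, by Minkowski's inequality in `L²(μ)`; hence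
`t ↦ Θ(t) · i` belongs to `γ(μ; H, Z)`, with an affine bound of its norm. -/
lemma exists_gaussNorm_mulBilin_le (hq : q ≠ ∞) {i : H →L[ℝ] Lp ℝ ∞ ν} {k : α → H} {K : ℝ≥0}
    (hk : IsBoundedKernel i k K) {P P' : X →L[ℝ] Lp ℝ q ν} (hP : ‖P‖ ≤ 1) (hP' : ‖P'‖ ≤ 1)
    {J : Lp ℝ q ν →L[ℝ] Z} (hJ : ‖J‖ ≤ 1) : ∃ C : ℝ≥0, C ≠ 0 ∧
      ∀ (μ : Measure A) [IsFiniteMeasure μ] (Θ : A → Lp ℝ q ν) (ψ : A → X) (c₀ c₁ : ℝ≥0),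
        MemLp Θ 2 μ → MemLp ψ 2 μ →
        (∀ t, ∀ᵐ s ∂ν, |Θ t s| ≤ c₀ + c₁ * (|P (ψ t) s| + |P' (ψ t) s|)) →
        gaussNorm μ (scalarFun ψ) ≠ ∞ →
        IsGaussFunction μ (fun t => J.comp (mulBilin i (Θ t))) ∧
        gaussNorm μ (fun t => J.comp (mulBilin i (Θ t))) ≤
          C * (c₀ * μ univ ^ (1 / 2 : ℝ) + c₁ * gaussNorm μ (scalarFun ψ)) := by
  have hq1 : 1 ≤ q := Fact.out
  have hq0 : q ≠ 0 := (zero_lt_one.trans_le hq1).ne'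
  obtain ⟨C₁, hC₁⟩ := exists_isRepresentedBy_isGaussianLimit (A := A) (H := H) (ν := ν) hq
  obtain ⟨C₂, hC₂⟩ := exists_squareFun_le_gaussNorm (A := A) (X := X) (ν := ν) hq
  have hνt : ν univ ^ (1 / q.toReal) ≠ ∞ :=
    ENNReal.rpow_ne_top_of_nonneg (by positivity) (measure_ne_top _ _)
  set N : ℝ≥0 := (ν univ ^ (1 / q.toReal)).toNNReal with hN
  -- The summand `1` only serves to make the constant nonzero.
  refine ⟨C₁ * (K * (N + 2 * C₂)) + 1, by positivity, fun μ _ Θ ψ c₀ c₁ hΘ hψ hdom hfin => ?_⟩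
  obtain ⟨θ, hθ, hθrep⟩ := exists_measurable_representative hq hΘ.aestronglyMeasurable
  obtain ⟨f, hf, hfrep⟩ := exists_measurable_representative hq
    (P.comp_memLp' hψ).aestronglyMeasurable
  obtain ⟨g, hg, hgrep⟩ := exists_measurable_representative hq
    (P'.comp_memLp' hψ).aestronglyMeasurable
  set γψ := gaussNorm μ (scalarFun ψ) with hγψ
  have hσm : ∀ {u : A × α → ℝ}, Measurable u → Measurable fun s =>
      (∫⁻ t, ‖u (t, s)‖ₑ ^ 2 ∂μ) ^ (1 / 2 : ℝ) := fun {u} hu =>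
    (Measurable.lintegral_prod_left' (f := fun p : A × α => ‖u p‖ₑ ^ 2)
      (hu.enorm.pow_const 2)).pow_const _
  have hf' := hC₂ μ P hP ψ hψ f hf hfrep
  have hg' := hC₂ μ P' hP' ψ hψ g hg hgrep
  have hpt : ∀ᵐ s ∂ν, ∀ᵐ t ∂μ, |θ (t, s)| ≤ c₀ + c₁ * (|f (t, s)| + |g (t, s)|) := by
    refine (Measure.ae_ae_comm (p := fun t s =>
      |θ (t, s)| ≤ c₀ + c₁ * (|f (t, s)| + |g (t, s)|)) ?_).1 ?_
    · exact measurableSet_le (by fun_prop) (by fun_prop)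
    · filter_upwards [hθrep, hfrep, hgrep] with t h1 h2 h3
      filter_upwards [h1, h2, h3, hdom t] with s a b c d
      simp only [Function.comp_apply] at b c
      rwa [a, b, c] at d
  have hσ : ∀ᵐ s ∂ν, (∫⁻ t, ‖θ (t, s)‖ₑ ^ 2 ∂μ) ^ (1 / 2 : ℝ) ≤
      c₀ * μ univ ^ (1 / 2 : ℝ) + c₁ * ((∫⁻ t, ‖f (t, s)‖ₑ ^ 2 ∂μ) ^ (1 / 2 : ℝ) +
        (∫⁻ t, ‖g (t, s)‖ₑ ^ 2 ∂μ) ^ (1 / 2 : ℝ)) := by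
    filter_upwards [hpt] with s hs
    have hfs : AEStronglyMeasurable (fun t => |f (t, s)|) μ := by
      have : Measurable fun t => f (t, s) := hf.comp measurable_prodMk_right
      exact (this.abs).aestronglyMeasurable
    have hgs : AEStronglyMeasurable (fun t => |g (t, s)|) μ := by
      have : Measurable fun t => g (t, s) := hg.comp measurable_prodMk_right
      exact (this.abs).aestronglyMeasurable
    simp_rw [← eLpNorm_two_eq_lintegral_sq (fun t => θ (t, s)),
      ← eLpNorm_two_eq_lintegral_sq (fun t => f (t, s)),
      ← eLpNorm_two_eq_lintegral_sq (fun t => g (t, s))]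
    calc eLpNorm (fun t => θ (t, s)) 2 μ
        ≤ eLpNorm ((fun _ => (c₀ : ℝ)) + (c₁ : ℝ) •
            ((fun t => |f (t, s)|) + fun t => |g (t, s)|)) 2 μ :=
          eLpNorm_mono_ae_real (by filter_upwards [hs] with t ht; exact ht)
      _ ≤ eLpNorm (fun _ : A => (c₀ : ℝ)) 2 μ + ‖(c₁ : ℝ)‖ₑ * (eLpNorm (fun t => |f (t, s)|) 2 μ +
            eLpNorm (fun t => |g (t, s)|) 2 μ) := by
          refine (eLpNorm_add_le aestronglyMeasurable_const ((hfs.add hgs).const_smul _)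
            (by norm_num)).trans ?_
          rw [eLpNorm_const_smul]
          gcongr
          exact eLpNorm_add_le hfs hgs (by norm_num)
      _ ≤ _ := by
          rw [eLpNorm_const' _ two_ne_zero ENNReal.ofNat_ne_top, NNReal.enorm_eq,
            NNReal.enorm_eq]
          have e : ∀ u : A → ℝ, eLpNorm (fun t => |u t|) 2 μ = eLpNorm u 2 μ :=
            fun u => eLpNorm_norm u
          rw [e, e]
          simp
  have hbound : eLpNorm (fun s => (∫⁻ t, ‖θ (t, s)‖ₑ ^ 2 ∂μ) ^ (1 / 2 : ℝ)) q ν ≤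
      (N + 2 * C₂) * (c₀ * μ univ ^ (1 / 2 : ℝ) + c₁ * γψ) := by
    have hfm := hσm hf
    have hgm := hσm hg
    set σf : α → ℝ≥0∞ := fun s => (∫⁻ t, ‖f (t, s)‖ₑ ^ 2 ∂μ) ^ (1 / 2 : ℝ) with hσf
    set σg : α → ℝ≥0∞ := fun s => (∫⁻ t, ‖g (t, s)‖ₑ ^ 2 ∂μ) ^ (1 / 2 : ℝ) with hσg
    set m := μ univ ^ (1 / 2 : ℝ) with hm
    calc eLpNorm (fun s => (∫⁻ t, ‖θ (t, s)‖ₑ ^ 2 ∂μ) ^ (1 / 2 : ℝ)) q ν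
        ≤ eLpNorm ((fun _ => c₀ * m) + fun s => c₁ * (σf + σg) s) q ν :=
          eLpNorm_mono_enorm_ae (by simpa [σf, σg] using hσ)
      _ ≤ eLpNorm (fun _ : α => c₀ * m) q ν + c₁ * (eLpNorm σf q ν + eLpNorm σg q ν) := by
          refine (eLpNorm_add_le aestronglyMeasurable_const
            ((hfm.add hgm).const_mul _).aestronglyMeasurable hq1).trans ?_
          rw [eLpNorm_const_mul_of_measurable hq0 hq _ (hfm.add hgm)]
          gcongr
          exact eLpNorm_add_le hfm.aestronglyMeasurable hgm.aestronglyMeasurable hq1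
      _ ≤ c₀ * m * N + c₁ * (C₂ * γψ + C₂ * γψ) := by
          gcongr
          rw [eLpNorm_const' _ hq0 hq, enorm_eq_self, hN, ENNReal.coe_toNNReal hνt]
      _ ≤ c₀ * m * N + c₁ * (C₂ * γψ + C₂ * γψ) + (c₁ * γψ * N + 2 * C₂ * (c₀ * m)) :=
          le_self_add
      _ = _ := by ring
  have hσfin : eLpNorm (fun s => (∫⁻ t, ‖θ (t, s)‖ₑ ^ 2 ∂μ) ^ (1 / 2 : ℝ)) q ν ≠ ∞ := by
    refine ne_top_of_le_ne_top ?_ hbound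
    have hm : μ univ ^ (1 / 2 : ℝ) ≠ ∞ :=
      ENNReal.rpow_ne_top_of_nonneg (by norm_num) (measure_ne_top _ _)
    finiteness
  obtain ⟨R, h, ζ, hR, hζ, hle⟩ := hC₁ i k K hk μ Θ hΘ θ hθ hθrep hσfin
  refine ⟨⟨J.comp R, hR.clm_comp J, h, _, hζ.clm_comp J⟩, ?_⟩
  have h1 : gaussNorm μ (fun t => J.comp (mulBilin i (Θ t))) ≤
      eLpNorm (fun ω => J (ζ ω)) 2 gaussianSequence :=
    (iInf₂_le (J.comp R) (hR.clm_comp J)).trans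
      ((iInf₂_le h (fun ω => J (ζ ω))).trans (iInf_le _ (hζ.clm_comp J)))
  calc _ ≤ eLpNorm (fun ω => J (ζ ω)) 2 gaussianSequence := h1
    _ ≤ ‖J‖₊ * eLpNorm ζ 2 gaussianSequence := eLpNorm_clm_comp_le J ζ 2
    _ ≤ 1 * (C₁ * (K * ((N + 2 * C₂) * (c₀ * μ univ ^ (1 / 2 : ℝ) + c₁ * γψ)))) := by
        gcongr
        · exact_mod_cast hJ
        · refine hle.trans ?_
          gcongr
    _ = (C₁ * (K * (N + 2 * C₂))) * (c₀ * μ univ ^ (1 / 2 : ℝ) + c₁ * γψ) := by ring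
    _ ≤ _ := by
        gcongr
        push_cast
        exact le_self_add

end NoiseEstimate

/-! ### Verification of the hypothesis on the noise operator -/

section Hypothesis

variable {d : ℕ} {S : SmoothDomain d} {q : ℝ≥0∞} [Fact (1 ≤ q)]
  {T : ℝ} {Ω : Type*} {mΩ : MeasurableSpace Ω}
  {𝓕 : Filtration (Icc (0 : ℝ) T) mΩ} {b : Icc (0 : ℝ) T → Ω → S.carrier → ℝ → ℝ → ℝ}

lemma MemLTwoGamma.gaussNorm_ne_top {M X : Type*} [MeasurableSpace M] [NormedAddCommGroup X]
    [NormedSpace ℝ X] {μ : Measure M} {φ : M → X} (hφ : MemLTwoGamma μ φ) :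
    gaussNorm μ (scalarFun φ) ≠ ∞ := by
  obtain ⟨⟨R, hR, h, ζ, hζ⟩, -⟩ := hφ
  refine ne_top_of_le_ne_top hζ.memLp.eLpNorm_ne_top ?_
  exact (iInf₂_le R hR).trans ((iInf₂_le h ζ).trans (iInf_le _ hζ))

lemma noiseOperator_eq (hb : IsCoefficient S 𝓕 b) (i₁ : LSpace S 2 →L[ℝ] LSpace S ∞)
    (t : Icc (0 : ℝ) T) (ω : Ω) (x : StateSpace S q) :
    noiseOperator hb i₁ t ω x = (ContinuousLinearMap.inr ℝ (EHalf S q) (LSpace S q)).comp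
      (mulBilin i₁ (superposition hb t ω x)) := rfl

lemma noiseOperator_apply (hb : IsCoefficient S 𝓕 b) (i₁ : LSpace S 2 →L[ℝ] LSpace S ∞)
    (t : Icc (0 : ℝ) T) (ω : Ω) (x : StateSpace S q) (h : LSpace S 2) :
    noiseOperator hb i₁ t ω x h = ((ContinuousLinearMap.inr ℝ (EHalf S q) (LSpace S q)).comp
      ((mulBilin i₁).flip h)) (superposition hb t ω x) := rfl

theorem hypothesisH4_noiseOperator (hq : q ≠ ∞) (hb : IsCoefficient S 𝓕 b)
    {i₁ : LSpace S 2 →L[ℝ] LSpace S ∞} {k : S.carrier → LSpace S 2} {K : ℝ≥0}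
    (hk : IsBoundedKernel i₁ k K) :
    HypothesisH4 𝓕 (fun t ω (x : StateSpace S q) => noiseOperator hb i₁ t ω x) := by
  have : Fact ((2 : ℝ≥0∞) ≠ ∞) := ⟨ENNReal.ofNat_ne_top⟩
  obtain ⟨C, hC0, hC⟩ := exists_gaussNorm_mulBilin_le (A := Icc (0 : ℝ) T) hq hk
    (norm_positionCLM_le (S := S) (q := q)) (norm_velocityCLM_le (S := S) (q := q))
    (ContinuousLinearMap.norm_inr_le_one ℝ (EHalf S q) (LSpace S q))
  obtain ⟨M, hM⟩ := exists_abs_superposition_le (q := q) hb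
  obtain ⟨L, hL0, hL⟩ := exists_abs_superposition_sub_le (q := q) hb
  refine ⟨fun x h => ?_, fun x h t => ?_, fun t ω h => ?_, fun μ _ ω φ hφ => ?_,
    ⟨C * L, fun μ _ ω φ₁ φ₂ h₁ h₂ => ?_⟩, ⟨C * M, fun μ _ ω φ hφ => ?_⟩⟩
  · simp_rw [noiseOperator_apply]
    exact (ContinuousLinearMap.continuous _).comp_stronglyMeasurable
      (stronglyMeasurable_superposition hq hb x)
  · simp_rw [noiseOperator_apply]
    exact (ContinuousLinearMap.continuous _).comp_stronglyMeasurable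
      (stronglyMeasurable_superposition_adapted hq hb t x)
  · simp_rw [noiseOperator_apply]
    exact (ContinuousLinearMap.continuous _).comp (continuous_superposition hb t ω)
  · simp_rw [noiseOperator_eq]
    exact (hC μ _ φ M M (memLp_superposition hq hb ω hφ.2) hφ.2 (fun t => hM t ω (φ t))
      hφ.gaussNorm_ne_top).1
  · -- If the difference is not a Gauss function, the right-hand side is infinite as `C * L ≠ 0`.
    by_cases hfin : gaussNorm μ (scalarFun fun t => φ₁ t - φ₂ t) = ∞
    · rw [lTwoGammaNorm, hfin, top_add, ENNReal.mul_top]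
      · exact le_top
      · simp [hC0, hL0]
    have e : ∀ t, noiseOperator hb i₁ t ω (φ₁ t) - noiseOperator hb i₁ t ω (φ₂ t) =
        (ContinuousLinearMap.inr ℝ (EHalf S q) (LSpace S q)).comp
          (mulBilin i₁ (superposition hb t ω (φ₁ t) - superposition hb t ω (φ₂ t))) := by
      intro t
      rw [noiseOperator_eq, noiseOperator_eq, ← ContinuousLinearMap.comp_sub, map_sub]
    simp_rw [e]
    have h3 := (hC μ (fun t => superposition hb t ω (φ₁ t) - superposition hb t ω (φ₂ t))
      (fun t => φ₁ t - φ₂ t) 0 L ((memLp_superposition hq hb ω h₁.2).sub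
        (memLp_superposition hq hb ω h₂.2)) (h₁.2.sub h₂.2) (fun t => by
          filter_upwards [hL t ω (φ₁ t) (φ₂ t)] with s hs
          rw [NNReal.coe_zero, zero_add]
          exact hs) hfin).2
    refine h3.trans ?_
    rw [ENNReal.coe_zero, zero_mul, zero_add, ← mul_assoc, ← ENNReal.coe_mul]
    gcongr
    exact le_self_add
  · simp_rw [noiseOperator_eq]
    refine ((hC μ _ φ M M (memLp_superposition hq hb ω hφ.2) hφ.2 (fun t => hM t ω (φ t))
      hφ.gaussNorm_ne_top).2).trans ?_
    rw [← mul_add, ← mul_assoc, ← ENNReal.coe_mul]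
    gcongr
    exact le_self_add

end Hypothesis

/-! ### Spectral decomposition of the covariance -/

section Spectral

/-- A compact symmetric operator on a Hilbert space has a Hilbert basis of eigenvectors: Hilbert
bases of the eigenspaces, taken together, form one. -/
lemma exists_hilbertBasis_eigenvectors {E : Type*} [NormedAddCommGroup E] [InnerProductSpace ℝ E]
    [CompleteSpace E] {Q : E →L[ℝ] E} (hQ : Q.IsSymmetric) (hQc : IsCompactOperator Q) :
    ∃ (w : Set E) (e : HilbertBasis w ℝ E) (lam : w → ℝ), ∀ i, Q (e i) = lam i • e i := by
  let V : ℝ → Submodule ℝ E := fun c => Module.End.eigenspace (Q : Module.End ℝ E) c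
  have hVc : ∀ c, IsClosed (V c : Set E) := by
    intro c
    have : (V c : Set E) = {x | Q x = c • x} := by
      ext x; simp [V]
    rw [this]
    exact isClosed_eq Q.continuous (continuous_const_smul c)
  have hVcomp : ∀ c, CompleteSpace (V c) := fun c => (hVc c).completeSpace_coe
  have horth : OrthogonalFamily ℝ (fun c => V c) fun c => (V c).subtypeₗᵢ :=
    hQ.orthogonalFamily_eigenspaces
  choose w b hb using fun c => exists_hilbertBasis ℝ (V c)
  let v : (Σ c, w c) → E := fun i => (b i.1 i.2 : E)
  have hv : Orthonormal ℝ v := horth.orthonormal_sigma_orthonormal fun c => (b c).orthonormal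
  have hspan : (Submodule.span ℝ (range v))ᗮ = ⊥ := by
    rw [eq_bot_iff, ← ContinuousLinearMap.orthogonalComplement_iSup_eigenspaces_eq_bot hQc hQ]
    rw [← Submodule.orthogonal_closure (Submodule.span ℝ (range v))]
    refine Submodule.orthogonal_le (iSup_le fun c x hx => ?_)
    have h1 := ((b c).hasSum_repr ⟨x, hx⟩).mapL (V c).subtypeL
    simp only [map_smul, Submodule.subtypeL_apply] at h1
    refine (Submodule.isClosed_topologicalClosure _).mem_of_tendsto h1
      (Eventually.of_forall fun F => Submodule.sum_mem _ fun i _ => Submodule.smul_mem _ _ ?_)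
    exact Submodule.le_topologicalClosure _ (Submodule.subset_span ⟨⟨c, i⟩, rfl⟩)
  have hr : Orthonormal ℝ ((↑) : range v → E) := hv.toSubtypeRange
  have heig : ∀ i : range v, ∃ c : ℝ, Q i = c • (i : E) := by
    rintro ⟨_, ⟨c, i⟩, rfl⟩
    exact ⟨c, Module.End.mem_eigenspace_iff.1 (b c i).2⟩
  choose lam hlam using heig
  refine ⟨range v, HilbertBasis.mkOfOrthogonalEqBot hr (by rwa [Subtype.range_coe]), lam,
    fun i => ?_⟩
  rw [HilbertBasis.coe_mkOfOrthogonalEqBot]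
  exact hlam i

variable {d : ℕ}

lemma SmoothDomain.infinite_carrier (hd : 1 ≤ d) (S : SmoothDomain d) : Infinite S.carrier := by
  have : Nonempty (Fin d) := ⟨⟨0, hd⟩⟩
  have hne := S.isConnected.nonempty
  obtain ⟨x, hx⟩ := hne
  have h1 : S.carrier ∈ 𝓝 x := S.isOpen.mem_nhds hx
  exact (infinite_of_mem_nhds x h1).to_subtype

lemma SmoothDomain.vol_pos_of_isOpen (S : SmoothDomain d) {U : Set S.carrier} (hU : IsOpen U)
    (hne : U.Nonempty) : S.vol U ≠ 0 := by
  rw [SmoothDomain.vol, comap_subtype_coe_apply S.isOpen.measurableSet]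
  exact ((S.isOpen.isOpenMap_subtype_val U hU).measure_pos volume (hne.image _)).ne'

/-- `L²(S)` is infinite dimensional, as `S` contains infinitely many disjoint open sets. -/
lemma exists_linearIndependent_nat (hd : 1 ≤ d) (S : SmoothDomain d) :
    ∃ f : ℕ → LSpace S 2, LinearIndependent ℝ f := by
  have := S.infinite_carrier hd
  obtain ⟨U, hUi, hUo, hUd⟩ := exists_seq_infinite_isOpen_pairwise_disjoint S.carrier
  have hm : ∀ n, MeasurableSet (U n) := fun n => (hUo n).measurableSet
  let f : ℕ → LSpace S 2 := fun n => indicatorConstLp 2 (hm n) (measure_ne_top S.vol (U n)) 1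
  refine ⟨f, linearIndependent_of_ne_zero_of_inner_eq_zero (𝕜 := ℝ) (fun n h0 => ?_)
    fun m n hmn => ?_⟩
  · rw [← norm_eq_zero, norm_indicatorConstLp two_ne_zero ENNReal.ofNat_ne_top] at h0
    have h1 : 0 < S.vol.real (U n) := ENNReal.toReal_pos
      (S.vol_pos_of_isOpen (hUo n) (hUi n).nonempty) (measure_ne_top _ _)
    rw [norm_one, one_mul] at h0
    exact (Real.rpow_pos_of_pos h1 _).ne' h0
  · have h1 := L2.real_inner_indicatorConstLp_one_indicatorConstLp_one (μ := S.vol) (hm m) (hm n)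
    rw [(hUd hmn).inter_eq, measureReal_empty] at h1
    exact h1

theorem exists_isSpectralDecomposition (hd : 1 ≤ d) (S : SmoothDomain d)
    {Q : LSpace S 2 →L[ℝ] LSpace S 2} (hQ : Q.IsPositive) (hQc : IsCompactOperator Q) :
    ∃ (lam : ℕ → ℝ) (e : ℕ → LSpace S 2), IsSpectralDecomposition Q lam e := by
  have : Fact ((2 : ℝ≥0∞) ≠ ∞) := ⟨ENNReal.ofNat_ne_top⟩
  obtain ⟨w, b, lam, hlam⟩ := exists_hilbertBasis_eigenvectors hQ.isSymmetric hQc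
  have hc : Countable w := countable_of_orthonormal b.orthonormal
  have hi : Infinite w := by
    by_contra hfin
    rw [not_infinite_iff_finite] at hfin
    have := Fintype.ofFinite w
    obtain ⟨f, hf⟩ := exists_linearIndependent_nat hd S
    have : FiniteDimensional ℝ (LSpace S 2) :=
      b.toOrthonormalBasis.toBasis.finiteDimensional_of_finite
    exact not_finite_iff_infinite.2 (inferInstance : Infinite ℕ) hf.finite
  obtain ⟨eqv⟩ := nonempty_equiv_of_countable (α := ℕ) (β := w)
  have ho := b.orthonormal
  refine ⟨fun n => lam (eqv n), fun n => b (eqv n), fun n => ?_, ho.comp _ eqv.injective,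
    fun h => ?_⟩
  · have h1 := hQ.inner_nonneg_right (b (eqv n))
    rw [hlam, real_inner_smul_right, real_inner_self_eq_norm_sq, ho.1] at h1
    simpa using h1
  · have h1 := (b.hasSum_repr h).mapL Q
    simp only [map_smul, hlam, HilbertBasis.repr_apply_apply] at h1
    have h2 := (eqv.hasSum_iff).2 h1
    refine h2.congr fun F => Finset.sum_congr rfl fun n _ => ?_
    simp only [Function.comp_apply, smul_smul]
    rw [mul_comm]

lemma IsSpectralDecomposition.apply_eq {S : SmoothDomain d} {Q : LSpace S 2 →L[ℝ] LSpace S 2}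
    {lam : ℕ → ℝ} {e : ℕ → LSpace S 2} (hQ : IsSpectralDecomposition Q lam e) (n : ℕ) :
    Q (e n) = lam n • e n := by
  have h1 := hasSum_single (f := fun m => (lam m * inner ℝ (e m) (e n)) • e m) n
    fun m hm => by rw [hQ.orthonormal.2 hm, mul_zero, zero_smul]
  rw [(hQ.hasSum (e n)).unique h1, real_inner_self_eq_norm_sq, hQ.orthonormal.1]
  simp

lemma IsSpectralDecomposition.le_opNorm {S : SmoothDomain d} {Q : LSpace S 2 →L[ℝ] LSpace S 2}
    {lam : ℕ → ℝ} {e : ℕ → LSpace S 2} (hQ : IsSpectralDecomposition Q lam e) (n : ℕ) :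
    lam n ≤ ‖Q‖ := by
  have h1 := Q.le_opNorm (e n)
  rw [hQ.apply_eq, norm_smul, hQ.orthonormal.1, mul_one, mul_one] at h1
  exact (le_abs_self _).trans h1

/-- Both conditions on the noise bound `∑ λₙ |eₙ|²` almost everywhere by a constant. -/
lemma exists_ae_tsum_le {α : Type*} [MeasurableSpace α] {ν : Measure α} {lam : ℕ → ℝ}
    (hlam : ∀ n, 0 ≤ lam n) {e : ℕ → α → ℝ}
    (h : (∑' n, ENNReal.ofReal (lam n) * eLpNorm (e n) ∞ ν ^ 2 < ∞) ∨
      eLpNorm (fun s => (∑' n, ENNReal.ofReal (lam n * |e n s| ^ 2)) ^ (1 / 2 : ℝ)) ∞ ν < ∞) :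
    ∃ K : ℝ≥0, ∀ᵐ s ∂ν, ∑' n, ENNReal.ofReal (lam n * |e n s| ^ 2) ≤ (K : ℝ≥0∞) ^ 2 := by
  have hsq : ∀ x : ℝ≥0∞, (x ^ (1 / 2 : ℝ)) ^ 2 = x := fun x => by
    rw [← ENNReal.rpow_two, ← ENNReal.rpow_mul]; norm_num
  rcases h with h | h
  · set B := ∑' n, ENNReal.ofReal (lam n) * eLpNorm (e n) ∞ ν ^ 2 with hB
    refine ⟨(B ^ (1 / 2 : ℝ)).toNNReal, ?_⟩
    rw [ENNReal.coe_toNNReal (ENNReal.rpow_ne_top_of_nonneg (by norm_num) h.ne), hsq]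
    have h1 : ∀ᵐ s ∂ν, ∀ n, ‖e n s‖ₑ ≤ eLpNorm (e n) ∞ ν :=
      ae_all_iff.2 fun n => by
        rw [eLpNorm_exponent_top]
        exact ae_le_eLpNormEssSup
    filter_upwards [h1] with s hs
    refine ENNReal.tsum_le_tsum fun n => ?_
    rw [ENNReal.ofReal_mul (hlam n), ENNReal.ofReal_pow (abs_nonneg _), ← Real.norm_eq_abs,
      ofReal_norm]
    gcongr
    exact hs n
  · refine ⟨(eLpNorm (fun s => (∑' n, ENNReal.ofReal (lam n * |e n s| ^ 2)) ^ (1 / 2 : ℝ))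
      ∞ ν).toNNReal, ?_⟩
    rw [ENNReal.coe_toNNReal h.ne, eLpNorm_exponent_top]
    filter_upwards [ae_le_eLpNormEssSup (μ := ν)
      (f := fun s => (∑' n, ENNReal.ofReal (lam n * |e n s| ^ 2)) ^ (1 / 2 : ℝ))] with s hs
    rw [enorm_eq_self] at hs
    calc _ = ((∑' n, ENNReal.ofReal (lam n * |e n s| ^ 2)) ^ (1 / 2 : ℝ)) ^ 2 := (hsq _).symm
      _ ≤ _ := by gcongr

end Spectral

end DampedPlate

end

theorem mainTheorem7 {d : ℕ} (hd : 1 ≤ d) (S : DampedPlate.SmoothDomain d)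
    (q : ℝ≥0∞) [Fact (1 ≤ q)] (hq : 1 < q) (hq' : q < ∞)
    {T : ℝ} (hT : 0 < T) {Ω : Type*} {mΩ : MeasurableSpace Ω}
    (𝓕 : Filtration (Icc (0 : ℝ) T) mΩ)
    (b : Icc (0 : ℝ) T → Ω → S.carrier → ℝ → ℝ → ℝ) (hb : DampedPlate.IsCoefficient S 𝓕 b)
    (Q₁ : DampedPlate.LSpace S 2 →L[ℝ] DampedPlate.LSpace S 2)
    (hQ : Q₁.IsPositive) (hQc : IsCompactOperator Q₁) :
    (∃ (lam : ℕ → ℝ) (e : ℕ → DampedPlate.LSpace S 2),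
      DampedPlate.IsSpectralDecomposition Q₁ lam e) ∧
    ∀ (lam : ℕ → ℝ) (e : ℕ → DampedPlate.LSpace S 2),
      DampedPlate.IsSpectralDecomposition Q₁ lam e →
      ((∑' n, ENNReal.ofReal (lam n) * eLpNorm (e n) ∞ S.vol ^ 2 < ∞) ∨
        eLpNorm (fun s => (∑' n, ENNReal.ofReal (lam n * |e n s| ^ 2)) ^ (1 / 2 : ℝ)) ∞ S.vol
          < ∞) →
      ∃ i₁ : DampedPlate.LSpace S 2 →L[ℝ] DampedPlate.LSpace S ∞,
        DampedPlate.IsNoiseEmbedding lam e i₁ ∧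
        DampedPlate.HypothesisH4 𝓕
          (fun t ω (x : DampedPlate.StateSpace S q) => DampedPlate.noiseOperator hb i₁ t ω x) := by
  refine ⟨DampedPlate.exists_isSpectralDecomposition hd S hQ hQc, fun lam e he h => ?_⟩
  obtain ⟨K, hK⟩ := DampedPlate.exists_ae_tsum_le he.nonneg h
  obtain ⟨i₁, k, hk, hi⟩ :=
    DampedPlate.exists_isBoundedKernel he.nonneg he.orthonormal he.le_opNorm hK
  exact ⟨i₁, hi, DampedPlate.hypothesisH4_noiseOperator hq'.ne hb hk⟩
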